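/- Consider the linear system $x_{k+1}=A_kx_k+B_ku_k+w_k$ with channel outputs $z_k=C_kx_k+v_k$, $k=0,\dots,N-1$, where $x_k,w_k\in\mathbb R^n$, $u_k\in\mathbb R^s$, $z_k,v_k\in\mathbb R^m$. The initial state $x_0$ (possibly deterministic) and the disturbances $w_k$ have finite second moments, $\mathbb E[w_k]=0$, and $x_0,w_0,\dots,w_{N-1},v_0,\dots,v_{N-1}$ are independent. Let $(\tau_k)$ be a Markov chain on $\{0,1\}$ (1 = ON, 0 = OFF), independent of these variables, with given initial state $\tau_0$ and $\Pr(\tau_{k+1}=1\mid\tau_k=1)=p$, $\Pr(\tau_{k+1}=1\mid\tau_k=0)=1-q$, where $p,q\in[0,1]$. The controller works without delay and with partial state information: at time $k$ it knows the history $H_k$, which consists of the measurements $z_i$, $i\le k$, for the times $i$ with $\tau_i=1$ (labelled by time), and of the controls $u_i$, $i<k$. A feasible policy $\pi=(\pi_0,\dots,\pi_{N-1})$ is a sequence of measurable maps $u_k=\pi_k(H_k,\tau_k)\in\mathbb R^s$ with $\pi_k(\cdot,0)=0$. With $Q_k$ ($0\le k\le N$) positive semidefinite and $R_k$ ($0\le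 k<N$) positive definite, let $$J^{\pi}(p,q)=\mathbb E\Big[x_N^\top Q_Nx_N+\sum_{k=0}^{N-1}\big(x_k^\top Q_kx_k+u_k^\top R_ku_k\big)\Big],\qquad J^\star(p,q)=\inf_{\pi\ \text{feasible}}J^\pi(p,q).$$ Assume $p>1-q$. Then $J^\star(1-q,q)<\infty$ and $$J^\star(p,1-p)\le J^\star(p,q)\le J^\star(1-q,q).$$ Moreover, the optimal controller of the symmetric case $(1-q,q)$ attains a cost between these bounds in the system with parameters $(p,q)$. Precisely, let $K_N=Q_N$ and, for $k<N$, let $V_k=(R_k+B_k^\top K_{k+1}B_k)^{-1}B_k^\top K_{k+1}A_k$ and $K_k=Q_k+A_k^\top K_{k+1}A_k-(1-q)\,A_k^\top K_{k+1}B_kV_k$. There is a feasible policy $\pi^\star$ which, both in the system with parameters $(1-q,q)$ and in the system with parameters $(p,q)$, satisfies $u_k=-V_k\,\mathbb E[x_k\mid H_k]\,\mathbf 1_{\{\tau_k=1\}}$ almost surely for all $k<N$; and every such policy satisfies $$J^{\pi^\star}(1-q,q)=J^\star(1-q,q),\qquad J^\star(p,1-p)\le J^{\pi^\star}(p,q)\le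 J^\star(1-q,q).$$ If $q<1$, then every feasible policy $\pi$ with $J^\pi(1-q,q)=J^\star(1-q,q)$ satisfies $J^\star(p,1-p)\le J^\pi(p,q)\le J^\star(1-q,q)$. -/

import Mathlib

open MeasureTheory ProbabilityTheory Matrix
open scoped ENNReal

namespace FogControl

/-- Transition probabilities of the two-state fog process (`true` is ON, `false` is OFF):
`P(ON ∣ ON) = p` and `P(ON ∣ OFF) = 1 - q`. -/
def transition (p q : ℝ) : Bool → Bool → ℝ
  | true, true => p
  | true, false => 1 - p
  | false, true => 1 - q
  | false, false => q

/-- Probability that the fog process started at `τ₀` follows the path `t`. -/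
noncomputable def pathProb (N : ℕ) (p q : ℝ) (τ₀ : Bool) (t : Fin (N + 1) → Bool) : ℝ :=
  (if t 0 = τ₀ then 1 else 0) * ∏ k : Fin N, transition p q (t k.castSucc) (t k.succ)

/-- Law of the Markov path `(τ_0, …, τ_N)` started at `τ₀` (the value `τ_N` is never used). -/
noncomputable def fogLaw (N : ℕ) (p q : ℝ) (τ₀ : Bool) : Measure (Fin (N + 1) → Bool) :=
  ∑ t : Fin (N + 1) → Bool, ENNReal.ofReal (pathProb N p q τ₀ t) • Measure.dirac t

/-- What the controller receives in one time slot: nothing (`Sum.inl ()`, when it is OFF) or a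
measurement (`Sum.inr z`, when it is ON). -/
abbrev Reading (m : ℕ) : Type := Unit ⊕ (Fin m → ℝ)

/-- Information sets at time `k`: the readings of the slots `0, …, k` and the control signals
of the slots `0, …, k - 1`. -/
abbrev History (m s k : ℕ) : Type := (Fin (k + 1) → Reading m) × (Fin k → (Fin s → ℝ))

/-- Control policies: `π k` maps the history and the fog state at time `k` to a control. -/
abbrev Policy (m s : ℕ) : Type := (k : ℕ) → History m s k → Bool → (Fin s → ℝ)

/-- A policy is feasible if it outputs no control whenever the fog controller is OFF
(and is, as always, a measurable function of the history). -/
def Feasible {m s : ℕ} (N : ℕ) (π : Policy m s) : Prop :=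
  ∀ k < N, (∀ b : Bool, Measurable fun h => π k h b) ∧ ∀ h, π k h false = 0

/-- A linear plant with horizon `N`, state dimension `n`, control dimension `s` and measurement
dimension `m`, with its random initial state (possibly constant), disturbances, measurement
noises, and quadratic cost weights. Sequences are indexed by `ℕ`, but only the terms up to the
horizon matter. -/
structure Plant (n s m N : ℕ) {Ω : Type*} [MeasurableSpace Ω] (P : Measure Ω) where
  A : ℕ → Matrix (Fin n) (Fin n) ℝ
  B : ℕ → Matrix (Fin n) (Fin s) ℝ
  C : ℕ → Matrix (Fin m) (Fin n) ℝ
  Q : ℕ → Matrix (Fin n) (Fin n) ℝ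
  R : ℕ → Matrix (Fin s) (Fin s) ℝ
  x₀ : Ω → (Fin n → ℝ)
  w : ℕ → Ω → (Fin n → ℝ)
  v : ℕ → Ω → (Fin m → ℝ)
  posSemidef_Q : ∀ k ≤ N, (Q k).PosSemidef
  posDef_R : ∀ k < N, (R k).PosDef
  measurable_x₀ : Measurable x₀
  measurable_w : ∀ k < N, Measurable (w k)
  measurable_v : ∀ k < N, Measurable (v k)
  memLp_x₀ : MemLp x₀ 2 P
  /-- the disturbances have a (finite) covariance matrix -/
  memLp_w : ∀ k < N, MemLp (w k) 2 P
  /-- the disturbances have mean zero -/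
  mean_w : ∀ k < N, ∫ ω, w k ω ∂P = 0
  /-- the initial state, the disturbances and the measurement noises are independent -/
  indep_x₀ : IndepFun x₀ (fun ω => ((fun k : Fin N => w k ω), (fun k : Fin N => v k ω))) P
  indep_w_v : IndepFun (fun ω => fun k : Fin N => w k ω) (fun ω => fun k : Fin N => v k ω) P
  iIndep_w : iIndepFun (fun k : Fin N => w k) P
  iIndep_v : iIndepFun (fun k : Fin N => v k) P

namespace Plant

variable {n s m N : ℕ} {Ω : Type*} [MeasurableSpace Ω] {P : Measure Ω}

/-- Sample space of the controlled system: a fog path and a noise sample. -/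
abbrev Sample (N : ℕ) (Ω : Type*) : Type _ := (Fin (N + 1) → Bool) × Ω

/-- The fog state `τ_k`. -/
def fog (k : ℕ) (y : Sample N Ω) : Bool := if h : k < N + 1 then y.1 ⟨k, h⟩ else false

/-- The law of the system with fog parameters `p`, `q` started at fog state `τ₀`: the fog
process is independent of the initial state and of the noises. -/
noncomputable def law (_S : Plant n s m N P) (p q : ℝ) (τ₀ : Bool) : Measure (Sample N Ω) :=
  (fogLaw N p q τ₀).prod P

/-- What reaches the controller at time `k` when the state is `x`: the measurement
`z_k = C_k x + v_k` if it is ON, nothing otherwise. -/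
def reading (S : Plant n s m N P) (y : Sample N Ω) (k : ℕ) (x : Fin n → ℝ) : Reading m :=
  if fog k y then Sum.inr (S.C k *ᵥ x + S.v k y.2) else Sum.inl ()

/-- The system run under the policy `π`: the state at time `k`, together with the readings and
the controls of the slots `0, …, k - 1`. -/
def run (S : Plant n s m N P) (π : Policy m s) (y : Sample N Ω) :
    (k : ℕ) → (Fin n → ℝ) × (Fin k → Reading m) × (Fin k → (Fin s → ℝ))
  | 0 => (S.x₀ y.2, Fin.elim0, Fin.elim0)
  | k + 1 =>
    let x := (run S π y k).1
    let zs : Fin (k + 1) → Reading m := Fin.snoc (run S π y k).2.1 (S.reading y k x)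
    let us := (run S π y k).2.2
    let u := π k (zs, us) (fog k y)
    (S.A k *ᵥ x + S.B k *ᵥ u + S.w k y.2, zs, Fin.snoc us u)

/-- The state `x_k`. -/
def state (S : Plant n s m N P) (π : Policy m s) (k : ℕ) (y : Sample N Ω) : Fin n → ℝ :=
  (S.run π y k).1

/-- The history `H_k`. -/
def history (S : Plant n s m N P) (π : Policy m s) (k : ℕ) (y : Sample N Ω) : History m s k :=
  (Fin.snoc (S.run π y k).2.1 (S.reading y k (S.state π k y)), (S.run π y k).2.2)

/-- The control signal `u_k = π_k(H_k, τ_k)`. -/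
def control (S : Plant n s m N P) (π : Policy m s) (k : ℕ) (y : Sample N Ω) : Fin s → ℝ :=
  π k (S.history π k y) (fog k y)

/-- The cost `x_Nᵀ Q_N x_N + ∑_{k < N} (x_kᵀ Q_k x_k + u_kᵀ R_k u_k)` of one realization. -/
def totalCost (S : Plant n s m N P) (π : Policy m s) (y : Sample N Ω) : ℝ :=
  S.state π N y ⬝ᵥ S.Q N *ᵥ S.state π N y +
    ∑ k ∈ Finset.range N, (S.state π k y ⬝ᵥ S.Q k *ᵥ S.state π k y +
      S.control π k y ⬝ᵥ S.R k *ᵥ S.control π k y)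

/-- The expected cost of the policy `π`; the total cost is nonnegative, and its expectation is
taken in `[0, ∞]`. -/
noncomputable def cost (S : Plant n s m N P) (π : Policy m s) (p q : ℝ) (τ₀ : Bool) : ℝ≥0∞ :=
  ∫⁻ y, ENNReal.ofReal (S.totalCost π y) ∂(S.law p q τ₀)

/-- The minimum cost `J⋆(p, q)`: the infimum over all feasible policies. -/
noncomputable def minCost (S : Plant n s m N P) (p q : ℝ) (τ₀ : Bool) : ℝ≥0∞ :=
  ⨅ (π : Policy m s) (_ : Feasible N π), S.cost π p q τ₀

/-- For the cost-to-go matrix `K = K_{k+1}`, the gain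
`V_k = (R_k + B_kᵀ K B_k)⁻¹ B_kᵀ K A_k`. -/
noncomputable def gainOf (S : Plant n s m N P) (k : ℕ) (K : Matrix (Fin n) (Fin n) ℝ) :
    Matrix (Fin s) (Fin n) ℝ :=
  (S.R k + (S.B k)ᵀ * K * S.B k)⁻¹ * (S.B k)ᵀ * K * S.A k

/-- One backward step of the Riccati recursion with ON probability `r`: `K_k = L_k - r Λ_k` with
`L_k = Q_k + A_kᵀ K_{k+1} A_k` and `Λ_k = A_kᵀ K_{k+1} B_k V_k`. -/
noncomputable def riccatiStep (S : Plant n s m N P) (r : ℝ) (k : ℕ)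
    (K : Matrix (Fin n) (Fin n) ℝ) : Matrix (Fin n) (Fin n) ℝ :=
  (S.Q k + (S.A k)ᵀ * K * S.A k) - r • ((S.A k)ᵀ * K * S.B k * S.gainOf k K)

/-- `riccatiBack r j` is the matrix `K_{N-j}`, starting from `K_N = Q_N`. -/
noncomputable def riccatiBack (S : Plant n s m N P) (r : ℝ) : ℕ → Matrix (Fin n) (Fin n) ℝ
  | 0 => S.Q N
  | j + 1 => S.riccatiStep r (N - (j + 1)) (riccatiBack S r j)

/-- The gain `V_k`, for `k < N`, in the symmetric case with ON probability `r`. -/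
noncomputable def gain (S : Plant n s m N P) (r : ℝ) (k : ℕ) : Matrix (Fin s) (Fin n) ℝ :=
  S.gainOf k (S.riccatiBack r (N - (k + 1)))

/-- The conditional expectation `E[x_k ∣ H_k]` in the system with fog parameters `p`, `q` that is
run under the policy `π`. -/
noncomputable def estimate (S : Plant n s m N P) (π : Policy m s) (p q : ℝ) (τ₀ : Bool) (k : ℕ) :
    Sample N Ω → (Fin n → ℝ) :=
  (S.law p q τ₀)[S.state π k | MeasurableSpace.comap (S.history π k) inferInstance]

/-- In the system with fog parameters `p`, `q`, the policy `π` applies the control law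
`u_k = -V_k E[x_k ∣ H_k] 1{τ_k = 1}` with the gains `V_k` of the symmetric case with ON
probability `r`. -/
def AppliesSymmetricControl (S : Plant n s m N P) (r : ℝ) (π : Policy m s) (p q : ℝ)
    (τ₀ : Bool) : Prop :=
  ∀ k < N, S.control π k =ᵐ[S.law p q τ₀]
    fun y => if fog k y then -(S.gain r k *ᵥ S.estimate π p q τ₀ k y) else 0

end Plant

end FogControl

/-! Fix `r` in `[0, 1]` and use the Riccati matrices, gains `V_k` and weights `M_k = R_k + B_kᵀ
K_{k+1} B_k` of the symmetric chain with ON probability `r`. Completing the square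
(`quadForm_riccati`) and telescoping (`integral_totalCost`) write the mean cost along a fixed fog
path as a constant depending only on `r`, plus the sum over `k` of `D_k - (1 - r) X_k`. Here `X_k`
and `D_k` are the `M_k`-weighted mean squares of `V_k x_k` and `V_k x_k + u_k`. In an OFF slot `D_k
= X_k`. In an ON slot Pythagoras gives `D_k = E_k + G_k`, with `E_k` the estimation error and `G_k ≥
0` a gap that vanishes for the control `-V_k E[x_k ∣ H_k]`. In both cases the summand is `1{ON} G_k
+ r E_k + (r - 1{ON}) (X_k - E_k)` (`deviationTerm_eq`).

Two facts control the average over fog paths. First, there is no dual effect: known controls can be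
subtracted from the readings (`comap_history_eq`), so `E_k` does not depend on the policy. It is
determined by the ON times before `k` and decreases when there are more of them, so its mean falls
when the chain is made more inclined to ON (`pathMean_le_of_transition_le`). Second, `X_k ≥ E_k`,
and this difference is determined by the fog before time `k`. By the Markov property `1{ON}` may be
replaced by a transition probability (`slackTerm_succ`), which fixes the sign of the last term. At
time 0 that term is the same for all policies and parameters.

Hence the cost is at least `baseCost r` plus the mean gap if `1 - q ≤ p ≤ r`, and at most that if `r
≤ p` and `r ≤ 1 - q`. The symmetric chain satisfies both, so its optimum is `baseCost r`, attained
at zero gap. The choices `r = p` and `r = 1 - q` give the two bounds. For arbitrary symmetric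
optimizers with `q < 1`, every fog path from `τ₀` is possible in the symmetric system, so a zero
mean gap is a zero gap on each path and carries over to `(p, q)`. -/

namespace FogControl

/-! ### Averages over the paths of the two-state chain -/

/-- Expectation of `g` along the fog path started at `τ`. -/
noncomputable def pathMean (N : ℕ) (p q : ℝ) (τ : Bool) (g : (Fin (N + 1) → Bool) → ℝ) : ℝ :=
  ∑ t, pathProb N p q τ t * g t

variable {p q : ℝ}

theorem transition_nonneg (hp : p ∈ Set.Icc (0 : ℝ) 1) (hq : q ∈ Set.Icc (0 : ℝ) 1) (a b : Bool) :
    0 ≤ transition p q a b := by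
  rcases hp with ⟨h1, h2⟩
  rcases hq with ⟨h3, h4⟩
  cases a <;> cases b <;> simp only [transition] <;> linarith

theorem transition_add (a : Bool) : transition p q a true + transition p q a false = 1 := by
  cases a <;> simp [transition]

theorem pathProb_nonneg (hp : p ∈ Set.Icc (0 : ℝ) 1) (hq : q ∈ Set.Icc (0 : ℝ) 1) {N : ℕ} (τ : Bool)
    (t : Fin (N + 1) → Bool) : 0 ≤ pathProb N p q τ t := by
  unfold pathProb
  have := Finset.prod_nonneg fun (k : Fin N) (_ : k ∈ Finset.univ) =>
    transition_nonneg hp hq (t k.castSucc) (t k.succ)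
  split_ifs <;> simp [this]

theorem pathProb_eq_zero {N : ℕ} {τ : Bool} {t : Fin (N + 1) → Bool} (h : t 0 ≠ τ) :
    pathProb N p q τ t = 0 := by
  simp [pathProb, h]

theorem eq_of_pathProb_ne_zero {N : ℕ} {τ : Bool} {t : Fin (N + 1) → Bool}
    (h : pathProb N p q τ t ≠ 0) : t 0 = τ := by
  by_contra h'
  exact h (pathProb_eq_zero h')

theorem pathProb_pos {N : ℕ} {τ : Bool} {t : Fin (N + 1) → Bool} (hp : p ∈ Set.Ioo (0 : ℝ) 1)
    (hq : q ∈ Set.Ioo (0 : ℝ) 1) (h : t 0 = τ) : 0 < pathProb N p q τ t := by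
  rcases hp with ⟨h1, h2⟩
  rcases hq with ⟨h3, h4⟩
  simp only [pathProb, h, if_true, one_mul]
  refine Finset.prod_pos fun k _ => ?_
  cases t k.castSucc <;> cases t k.succ <;> simp only [transition] <;> linarith

/-- Only the summand `b = t 0` survives; the sum over `b` is the form that yields the one-step
recursion `pathMean_succ`. -/
theorem pathProb_cons {N : ℕ} (τ a : Bool) (t : Fin (N + 1) → Bool) :
    pathProb (N + 1) p q τ (Fin.cons a t) =
      if a = τ then ∑ b, transition p q τ b * pathProb N p q b t else 0 := by
  split_ifs with h
  · subst h
    simp only [pathProb, Fin.cons_zero, if_true, one_mul, Fin.prod_univ_succ, Fintype.sum_bool,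
      Fin.castSucc_zero, Fin.cons_succ]
    have : ∀ k : Fin N, (Fin.cons a t : Fin (N + 2) → Bool) k.succ.castSucc = t k.castSucc := by
      intro k
      rw [← Fin.succ_castSucc, Fin.cons_succ]
    simp only [this]
    cases t 0 <;> simp
  · exact pathProb_eq_zero (by simpa using h)

theorem pathMean_succ (N : ℕ) (τ : Bool) (g : (Fin (N + 2) → Bool) → ℝ) :
    pathMean (N + 1) p q τ g =
      ∑ b, transition p q τ b * pathMean N p q b fun t => g (Fin.cons τ t) := by
  unfold pathMean
  rw [← (Fin.consEquiv fun _ => Bool).sum_comp, Fintype.sum_prod_type]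
  change ∑ a : Bool, ∑ t : Fin (N + 1) → Bool, pathProb (N + 1) p q τ (Fin.cons a t) *
    g (Fin.cons a t) = _
  simp only [pathProb_cons, ite_mul, zero_mul, Finset.mul_sum]
  rw [Finset.sum_comm, Finset.sum_comm (s := (Finset.univ : Finset Bool))]
  refine Finset.sum_congr rfl fun t _ => ?_
  rw [Finset.sum_ite_eq' Finset.univ τ, if_pos (Finset.mem_univ _), Finset.sum_mul]
  exact Finset.sum_congr rfl fun b _ => by ring

theorem pathMean_zero (τ : Bool) (g : (Fin 1 → Bool) → ℝ) :
    pathMean 0 p q τ g = g fun _ => τ := by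
  unfold pathMean
  rw [← (Equiv.funUnique (Fin 1) Bool).symm.sum_comp]
  cases τ <;> simp [pathProb] <;> rfl

theorem pathMean_congr {N : ℕ} {τ : Bool} {g h : (Fin (N + 1) → Bool) → ℝ}
    (H : ∀ t, pathProb N p q τ t ≠ 0 → g t = h t) :
    pathMean N p q τ g = pathMean N p q τ h := by
  refine Finset.sum_congr rfl fun t _ => ?_
  by_cases ht : pathProb N p q τ t = 0
  · simp [ht]
  · rw [H t ht]

theorem pathMean_mono (hp : p ∈ Set.Icc (0 : ℝ) 1) (hq : q ∈ Set.Icc (0 : ℝ) 1) {N : ℕ} {τ : Bool}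
    {g h : (Fin (N + 1) → Bool) → ℝ} (H : ∀ t, pathProb N p q τ t ≠ 0 → g t ≤ h t) :
    pathMean N p q τ g ≤ pathMean N p q τ h := by
  refine Finset.sum_le_sum fun t _ => ?_
  by_cases ht : pathProb N p q τ t = 0
  · simp [ht]
  · exact mul_le_mul_of_nonneg_left (H t ht) (pathProb_nonneg hp hq _ _)

theorem pathMean_add {N : ℕ} {τ : Bool} (g h : (Fin (N + 1) → Bool) → ℝ) :
    pathMean N p q τ (fun t => g t + h t) = pathMean N p q τ g + pathMean N p q τ h := by
  simp [pathMean, mul_add, Finset.sum_add_distrib]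

theorem pathMean_sum {ι : Type*} {N : ℕ} {τ : Bool} (s : Finset ι)
    (g : ι → (Fin (N + 1) → Bool) → ℝ) :
    pathMean N p q τ (fun t => ∑ i ∈ s, g i t) = ∑ i ∈ s, pathMean N p q τ (g i) := by
  simp only [pathMean, Finset.mul_sum]
  rw [Finset.sum_comm]

theorem pathMean_const_mul {N : ℕ} {τ : Bool} (c : ℝ) (g : (Fin (N + 1) → Bool) → ℝ) :
    pathMean N p q τ (fun t => c * g t) = c * pathMean N p q τ g := by
  simp only [pathMean, Finset.mul_sum]
  exact Finset.sum_congr rfl fun t _ => by ring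

theorem pathMean_const (N : ℕ) (τ : Bool) (c : ℝ) : pathMean N p q τ (fun _ => c) = c := by
  induction N generalizing τ with
  | zero => rw [pathMean_zero]
  | succ N ih =>
    rw [pathMean_succ]
    simp only [ih, Fintype.sum_bool, ← add_mul, transition_add, one_mul]

theorem pathMean_start {N : ℕ} {τ : Bool} (g : Bool → (Fin (N + 1) → Bool) → ℝ) :
    pathMean N p q τ (fun t => g (t 0) t) = pathMean N p q τ (g τ) :=
  pathMean_congr fun t ht => by rw [eq_of_pathProb_ne_zero ht]

/-- The Markov property: given the past, the next state is ON with probability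
`transition p q _ true`. -/
theorem pathMean_next {N : ℕ} (k : Fin N) (τ : Bool) {Y : (Fin (N + 1) → Bool) → ℝ}
    (hY : ∀ t t' : Fin (N + 1) → Bool, (∀ i ≤ k.castSucc, t i = t' i) → Y t = Y t') :
    pathMean N p q τ (fun t => ((if t k.succ then 1 else 0) -
      transition p q (t k.castSucc) true) * Y t) = 0 := by
  induction N generalizing τ with
  | zero => exact k.elim0
  | succ N ih =>
    rw [pathMean_succ]
    -- For `k = 0` the function `Y` sees only the initial state and is a constant, so a single
    -- transition is averaged. For larger `k` the first step is conditioned away and the induction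
    -- hypothesis applies to the tail.
    refine Fin.cases ?_ (fun k => ?_) k (motive := fun k =>
      (∀ t t' : Fin (N + 2) → Bool, (∀ i ≤ k.castSucc, t i = t' i) → Y t = Y t') →
      ∑ b, transition p q τ b * pathMean N p q b (fun t =>
        ((if (Fin.cons τ t : Fin (N + 2) → Bool) k.succ then 1 else 0) -
        transition p q ((Fin.cons τ t : Fin (N + 2) → Bool) k.castSucc) true) *
          Y (Fin.cons τ t)) = 0) hY
    · intro hY
      have hc : ∀ t : Fin (N + 1) → Bool, Y (Fin.cons τ t) = Y (fun _ => τ) := by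
        intro t
        apply hY
        intro i hi
        have : i = 0 := by simpa using hi
        subst this
        rfl
      simp only [hc, Fin.castSucc_zero, Fin.cons_zero, Fin.cons_succ]
      have h1 : ∀ b, pathMean N p q b (fun t => ((if t 0 then 1 else 0) -
          transition p q τ true) * Y (fun _ => τ)) =
          ((if b then 1 else 0) - transition p q τ true) * Y (fun _ => τ) := by
        intro b
        rw [pathMean_start (fun b _ => ((if b then 1 else 0) -
          transition p q τ true) * Y (fun _ => τ)), pathMean_const]
      simp only [h1, Fintype.sum_bool]
      have := transition_add (p := p) (q := q) τ
      have h2 : transition p q τ false = 1 - transition p q τ true := by linarith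
      simp only [h2]
      simp
      ring
    · intro hY
      simp only [Fin.cons_succ, ← Fin.succ_castSucc]
      have := fun b => ih k b (Y := fun t => Y (Fin.cons τ t)) (fun t t' h => hY _ _ (by
        intro i hi
        induction i using Fin.cases with
        | zero => rfl
        | succ i => exact h i (by
            rw [← Fin.succ_castSucc] at hi; exact Fin.succ_le_succ_iff.mp hi)))
      simp only [this, mul_zero, Finset.sum_const_zero]

/-- Starting ON lowers the mean twice: the first coordinate is larger, and by `1 - q ≤ p` the next
state is ON at least as often. This is where the positive correlation of the chain enters. -/
theorem pathMean_start_antitone (hp : p ∈ Set.Icc (0 : ℝ) 1) (hq : q ∈ Set.Icc (0 : ℝ) 1)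
    (hpq : 1 - q ≤ p) {N : ℕ} {g : (Fin (N + 1) → Bool) → ℝ} (hg : Antitone g) :
    pathMean N p q true g ≤ pathMean N p q false g := by
  induction N with
  | zero =>
    rw [pathMean_zero, pathMean_zero]
    exact hg fun _ => Bool.false_le _
  | succ N ih =>
    rw [pathMean_succ, pathMean_succ]
    have hc : ∀ a : Bool, Antitone fun t : Fin (N + 1) → Bool => g (Fin.cons a t) := fun a t t' h =>
      hg (Fin.cons_le_cons.2 ⟨le_rfl, h⟩)
    have h1 : ∀ b, pathMean N p q b (fun t => g (Fin.cons true t)) ≤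
        pathMean N p q b (fun t => g (Fin.cons false t)) := fun b =>
      pathMean_mono hp hq fun t _ => hg (Fin.cons_le_cons.2 ⟨Bool.false_le _, le_rfl⟩)
    calc _ ≤ ∑ b, transition p q true b * pathMean N p q b fun t => g (Fin.cons false t) :=
          Finset.sum_le_sum fun b _ =>
            mul_le_mul_of_nonneg_left (h1 b) (transition_nonneg hp hq _ _)
      _ ≤ _ := by
        have := ih (hc false)
        simp only [Fintype.sum_bool, transition]
        nlinarith

/-- Raising the probabilities of turning or staying ON lowers the mean of an antitone function of
the fog path. -/
theorem pathMean_le_of_transition_le {p' q' : ℝ} (hp : p ∈ Set.Icc (0 : ℝ) 1)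
    (hq : q ∈ Set.Icc (0 : ℝ) 1) (hp' : p' ∈ Set.Icc (0 : ℝ) 1) (hq' : q' ∈ Set.Icc (0 : ℝ) 1)
    (hpq : 1 - q ≤ p) (hpp : p ≤ p') (hqq : q' ≤ q) {N : ℕ} (τ : Bool)
    {g : (Fin (N + 1) → Bool) → ℝ} (hg : Antitone g) :
    pathMean N p' q' τ g ≤ pathMean N p q τ g := by
  induction N generalizing τ with
  | zero => rw [pathMean_zero, pathMean_zero]
  | succ N ih =>
    rw [pathMean_succ, pathMean_succ]
    have hc : Antitone fun t : Fin (N + 1) → Bool => g (Fin.cons τ t) := fun t t' h =>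
      hg (Fin.cons_le_cons.2 ⟨le_rfl, h⟩)
    -- The parameters of the tail are changed first, by induction, and those of the first transition
    -- afterwards, which moves mass to ON, the starting state with the smaller mean.
    calc _ ≤ ∑ b, transition p' q' τ b * pathMean N p q b fun t => g (Fin.cons τ t) :=
          Finset.sum_le_sum fun b _ =>
            mul_le_mul_of_nonneg_left (ih b hc) (transition_nonneg hp' hq' _ _)
      _ ≤ _ := by
        have := pathMean_start_antitone hp hq hpq hc
        cases τ <;> simp only [Fintype.sum_bool, transition] <;> nlinarith

/-! ### Quadratic forms and completing the square -/

section LinearAlgebra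

variable {n s : ℕ}

theorem mulVec_dotProduct {a b : ℕ} (A : Matrix (Fin a) (Fin b) ℝ) (x : Fin b → ℝ) (y : Fin a → ℝ) :
    A *ᵥ x ⬝ᵥ y = x ⬝ᵥ Aᵀ *ᵥ y := by
  rw [dotProduct_mulVec, vecMul_transpose]

theorem dotProduct_mulVec_comm {M : Matrix (Fin n) (Fin n) ℝ} (hM : Mᵀ = M) (x y : Fin n → ℝ) :
    x ⬝ᵥ M *ᵥ y = y ⬝ᵥ M *ᵥ x := by
  rw [dotProduct_comm, mulVec_dotProduct, hM]

theorem quadForm_add {M : Matrix (Fin n) (Fin n) ℝ} (hM : Mᵀ = M) (x y : Fin n → ℝ) :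
    (x + y) ⬝ᵥ M *ᵥ (x + y) = x ⬝ᵥ M *ᵥ x + 2 * (x ⬝ᵥ M *ᵥ y) + y ⬝ᵥ M *ᵥ y := by
  rw [mulVec_add, add_dotProduct, dotProduct_add, dotProduct_add, dotProduct_mulVec_comm hM y x]
  ring

theorem transpose_eq_of_posSemidef {M : Matrix (Fin n) (Fin n) ℝ} (hM : M.PosSemidef) : Mᵀ = M := by
  have := hM.isHermitian
  rwa [Matrix.IsHermitian, conjTranspose_eq_transpose_of_trivial] at this

theorem quadForm_nonneg {M : Matrix (Fin n) (Fin n) ℝ} (hM : M.PosSemidef) (x : Fin n → ℝ) :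
    0 ≤ x ⬝ᵥ M *ᵥ x := by
  simpa using hM.dotProduct_mulVec_nonneg x

/-- Completing the square in one step of the linear-quadratic problem. -/
theorem complete_square {A : Matrix (Fin n) (Fin n) ℝ} {B : Matrix (Fin n) (Fin s) ℝ}
    {K : Matrix (Fin n) (Fin n) ℝ} {R : Matrix (Fin s) (Fin s) ℝ} {V : Matrix (Fin s) (Fin n) ℝ}
    (hK : Kᵀ = K) (hR : Rᵀ = R) (hV : (R + Bᵀ * K * B) * V = Bᵀ * K * A)
    (x : Fin n → ℝ) (u : Fin s → ℝ) :
    (A *ᵥ x + B *ᵥ u) ⬝ᵥ K *ᵥ (A *ᵥ x + B *ᵥ u) + u ⬝ᵥ R *ᵥ u =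
      x ⬝ᵥ (Aᵀ * K * A) *ᵥ x - x ⬝ᵥ (Aᵀ * K * B * V) *ᵥ x +
        (V *ᵥ x + u) ⬝ᵥ (R + Bᵀ * K * B) *ᵥ (V *ᵥ x + u) := by
  have hM : (R + Bᵀ * K * B)ᵀ = R + Bᵀ * K * B := by
    simp only [transpose_add, transpose_mul, transpose_transpose, hK, hR, Matrix.mul_assoc]
  have hV' : Vᵀ * (R + Bᵀ * K * B) = Aᵀ * K * B := by
    have := congrArg transpose hV
    rw [transpose_mul, hM] at this
    rw [this]
    simp only [transpose_mul, transpose_transpose, hK, Matrix.mul_assoc]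
  rw [quadForm_add hK, quadForm_add hM]
  have h1 : V *ᵥ x ⬝ᵥ (R + Bᵀ * K * B) *ᵥ V *ᵥ x = x ⬝ᵥ (Aᵀ * K * B * V) *ᵥ x := by
    rw [mulVec_dotProduct, mulVec_mulVec, mulVec_mulVec, hV']
  have h2 : V *ᵥ x ⬝ᵥ (R + Bᵀ * K * B) *ᵥ u = A *ᵥ x ⬝ᵥ K *ᵥ B *ᵥ u := by
    rw [mulVec_dotProduct, mulVec_dotProduct, mulVec_mulVec, mulVec_mulVec, mulVec_mulVec, hV']
  have h3 : A *ᵥ x ⬝ᵥ K *ᵥ A *ᵥ x = x ⬝ᵥ (Aᵀ * K * A) *ᵥ x := by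
    rw [mulVec_dotProduct, mulVec_mulVec, mulVec_mulVec]
  have h4 : B *ᵥ u ⬝ᵥ K *ᵥ B *ᵥ u = u ⬝ᵥ (Bᵀ * K * B) *ᵥ u := by
    rw [mulVec_dotProduct, mulVec_mulVec, mulVec_mulVec]
  rw [h1, h2, h3, h4, add_mulVec, dotProduct_add]
  ring

/-- The case `u = 0` of `complete_square`: it exhibits the term that the Riccati step scales by `r`
as a weighted square of `V x`. -/
theorem complete_square_zero {A : Matrix (Fin n) (Fin n) ℝ} {B : Matrix (Fin n) (Fin s) ℝ}
    {K : Matrix (Fin n) (Fin n) ℝ} {R : Matrix (Fin s) (Fin s) ℝ} {V : Matrix (Fin s) (Fin n) ℝ}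
    (hK : Kᵀ = K) (hR : Rᵀ = R) (hV : (R + Bᵀ * K * B) * V = Bᵀ * K * A) (x : Fin n → ℝ) :
    x ⬝ᵥ (Aᵀ * K * B * V) *ᵥ x = V *ᵥ x ⬝ᵥ (R + Bᵀ * K * B) *ᵥ V *ᵥ x := by
  have h := complete_square hK hR hV x 0
  have h3 : A *ᵥ x ⬝ᵥ K *ᵥ A *ᵥ x = x ⬝ᵥ (Aᵀ * K * A) *ᵥ x := by
    rw [mulVec_dotProduct, mulVec_mulVec, mulVec_mulVec]
  simp only [mulVec_zero, add_zero, dotProduct_zero, h3] at h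
  linarith

theorem posDef_add_conj {B : Matrix (Fin n) (Fin s) ℝ} {K : Matrix (Fin n) (Fin n) ℝ}
    {R : Matrix (Fin s) (Fin s) ℝ} (hK : K.PosSemidef) (hR : R.PosDef) :
    (R + Bᵀ * K * B).PosDef := by
  have := hK.conjTranspose_mul_mul_same B
  rw [conjTranspose_eq_transpose_of_trivial] at this
  exact hR.add_posSemidef this

/-- Cauchy–Schwarz for the inner product of `R`, applied to `u` and `y = R⁻¹ e_i`, whose product is
`u i`. -/
theorem exists_sq_le_quadForm {R : Matrix (Fin n) (Fin n) ℝ} (hR : R.PosDef) (i : Fin n) :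
    ∃ C : ℝ, ∀ u : Fin n → ℝ, u i ^ 2 ≤ C * (u ⬝ᵥ R *ᵥ u) := by
  have hs := transpose_eq_of_posSemidef hR.posSemidef
  set y : Fin n → ℝ := R⁻¹ *ᵥ Pi.single i 1
  have hy : R *ᵥ y = Pi.single i 1 := by
    rw [mulVec_mulVec, mul_nonsing_inv _ ((isUnit_iff_isUnit_det _).1 hR.isUnit), one_mulVec]
  have hc := quadForm_nonneg hR.posSemidef y
  -- The sharp constant is `yᵀ R y`; adding 1 makes it visibly positive, so that one can divide by
  -- it.
  refine ⟨y ⬝ᵥ R *ᵥ y + 1, fun u => ?_⟩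
  set c := y ⬝ᵥ R *ᵥ y
  have h := quadForm_nonneg hR.posSemidef (u + (-(u i / (c + 1))) • y)
  rw [quadForm_add hs, mulVec_smul, hy, dotProduct_smul, dotProduct_single_one, dotProduct_smul,
    smul_dotProduct] at h
  have hc' : y ⬝ᵥ Pi.single i 1 = c := by rw [← hy]
  rw [hc'] at h
  simp only [smul_eq_mul] at h
  have hpos : 0 < c + 1 := by linarith
  have h2 : u i = (c + 1) * (u i / (c + 1)) := by field_simp
  set l := u i / (c + 1)
  rw [h2] at h ⊢
  nlinarith [sq_nonneg l, mul_nonneg hc (sq_nonneg l), mul_nonneg hpos.le h]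

end LinearAlgebra

/-! ### Conditional expectation and weighted mean square error -/

section SquareIntegrable

variable {Ω : Type*} {m mΩ : MeasurableSpace Ω} {P : Measure Ω} {a b : ℕ}

theorem memLp_mulVec (A : Matrix (Fin a) (Fin b) ℝ) {x : Ω → Fin b → ℝ} (hx : MemLp x 2 P) :
    MemLp (fun ω => A *ᵥ x ω) 2 P :=
  (LinearMap.toContinuousLinearMap A.mulVecLin).comp_memLp' hx

theorem integrable_dotProduct {x y : Ω → Fin a → ℝ} (hx : MemLp x 2 P) (hy : MemLp y 2 P) :
    Integrable (fun ω => x ω ⬝ᵥ y ω) P := by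
  unfold dotProduct
  exact integrable_finsetSum _ fun i _ => (hx.eval i).integrable_mul (hy.eval i)

theorem integrable_quadForm (A : Matrix (Fin a) (Fin b) ℝ) {x : Ω → Fin a → ℝ} {y : Ω → Fin b → ℝ}
    (hx : MemLp x 2 P) (hy : MemLp y 2 P) : Integrable (fun ω => x ω ⬝ᵥ A *ᵥ y ω) P :=
  integrable_dotProduct hx (memLp_mulVec A hy)

/-- A vector with integrable positive definite quadratic form is square integrable. -/
theorem memLp_two_of_posDef {R : Matrix (Fin a) (Fin a) ℝ} (hR : R.PosDef) {u : Ω → Fin a → ℝ}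
    (hu : Measurable u) (h : ∫⁻ ω, ENNReal.ofReal (u ω ⬝ᵥ R *ᵥ u ω) ∂P ≠ ⊤) : MemLp u 2 P := by
  have hMeas : ∀ A : Matrix (Fin a) (Fin a) ℝ, Measurable fun y : Fin a → ℝ => A *ᵥ y := fun A =>
    (LinearMap.toContinuousLinearMap A.mulVecLin).measurable
  have hquad : Measurable fun ω => u ω ⬝ᵥ R *ᵥ u ω := by
    unfold dotProduct
    exact Finset.measurable_sum _ fun i _ => ((measurable_pi_apply i).comp hu).mul
      ((measurable_pi_apply i).comp ((hMeas R).comp hu))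
  have hint : Integrable (fun ω => u ω ⬝ᵥ R *ᵥ u ω) P :=
    (lintegral_ofReal_ne_top_iff_integrable hquad.aestronglyMeasurable
      (Filter.Eventually.of_forall fun ω => quadForm_nonneg hR.posSemidef _)).1 h
  refine MemLp.of_eval fun i => ?_
  have hui : Measurable fun ω => u ω i := (measurable_pi_apply i).comp hu
  obtain ⟨C, hC⟩ := exists_sq_le_quadForm hR i
  rw [memLp_two_iff_integrable_sq hui.aestronglyMeasurable]
  refine (hint.const_mul C).mono' (hui.pow_const 2).aestronglyMeasurable ?_
  refine Filter.Eventually.of_forall fun ω => ?_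
  rw [Real.norm_of_nonneg (sq_nonneg _)]
  exact hC _

variable [IsProbabilityMeasure P]

/-- In each component the known factor can be pulled out of the conditional expectation. -/
theorem integral_dotProduct_sub_condExp (hm : m ≤ mΩ) {g x : Ω → Fin a → ℝ}
    (hgm : Measurable[m] g) (hg : MemLp g 2 P) (hx : MemLp x 2 P) :
    ∫ ω, g ω ⬝ᵥ (x ω - (P[x | m]) ω) ∂P = 0 := by
  have hxi : Integrable x P := hx.integrable (by norm_num)
  have hc : MemLp (P[x | m]) 2 P := hx.condExp (by norm_num)
  have key : ∀ i, ∫ ω, g ω i * (x ω - (P[x | m]) ω) i ∂P = 0 := by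
    intro i
    have hgi : StronglyMeasurable[m] fun ω => g ω i :=
      ((measurable_pi_apply i).comp hgm).stronglyMeasurable
    have h1 : (fun ω => (P[x | m]) ω i) =ᵐ[P] P[fun ω => x ω i | m] :=
      ContinuousLinearMap.comp_condExp_comm hxi
        (ContinuousLinearMap.proj (R := ℝ) (φ := fun _ : Fin a => ℝ) i)
    have hint : Integrable (fun ω => g ω i * x ω i) P := (hg.eval i).integrable_mul (hx.eval i)
    have h2 := condExp_mul_of_stronglyMeasurable_left (μ := P) hgi hint
      ((hx.eval i).integrable (by norm_num))
    have h3 : ∫ ω, g ω i * (P[x | m]) ω i ∂P = ∫ ω, g ω i * x ω i ∂P := by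
      rw [← integral_condExp hm (f := fun ω => g ω i * x ω i)]
      refine integral_congr_ae ?_
      filter_upwards [h1, h2] with ω h1 h2
      rw [h1]
      exact h2.symm
    simp only [Pi.sub_apply, mul_sub]
    have hint' : Integrable (fun ω => g ω i * (P[x | m]) ω i) P :=
      (hg.eval i).integrable_mul (hc.eval i)
    rw [integral_sub hint hint', h3, sub_self]
  unfold dotProduct
  rw [integral_finsetSum]
  · simp only [key, Finset.sum_const_zero]
  · intro i _
    exact (hg.eval i).integrable_mul ((hx.sub hc).eval i)

/-- Pythagoras for the conditional expectation and a quadratic form. -/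
theorem integral_quadForm_condExp (hm : m ≤ mΩ) {M : Matrix (Fin a) (Fin a) ℝ} (hM : Mᵀ = M)
    (V : Matrix (Fin a) (Fin b) ℝ) {x : Ω → Fin b → ℝ} {c : Ω → Fin a → ℝ} (hx : MemLp x 2 P)
    (hcm : Measurable[m] c) (hc : MemLp c 2 P) :
    ∫ ω, (V *ᵥ x ω + c ω) ⬝ᵥ M *ᵥ (V *ᵥ x ω + c ω) ∂P =
      ∫ ω, V *ᵥ (x ω - (P[x | m]) ω) ⬝ᵥ M *ᵥ V *ᵥ (x ω - (P[x | m]) ω) ∂P +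
        ∫ ω, (V *ᵥ (P[x | m]) ω + c ω) ⬝ᵥ M *ᵥ (V *ᵥ (P[x | m]) ω + c ω) ∂P := by
  have hxh : MemLp (P[x | m]) 2 P := hx.condExp (by norm_num)
  have he : MemLp (fun ω => V *ᵥ (x ω - (P[x | m]) ω)) 2 P := memLp_mulVec V (hx.sub hxh)
  have hh : MemLp (fun ω => V *ᵥ (P[x | m]) ω + c ω) 2 P := (memLp_mulVec V hxh).add hc
  have hV : Measurable fun y : Fin b → ℝ => V *ᵥ y :=
    (LinearMap.toContinuousLinearMap V.mulVecLin).measurable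
  have hW : Measurable fun y : Fin a → ℝ => (Vᵀ * M) *ᵥ y :=
    (LinearMap.toContinuousLinearMap (Vᵀ * M).mulVecLin).measurable
  have hgm : Measurable[m] fun ω => (Vᵀ * M) *ᵥ (V *ᵥ (P[x | m]) ω + c ω) :=
    hW.comp ((hV.comp stronglyMeasurable_condExp.measurable).add hcm)
  have h0 := integral_dotProduct_sub_condExp hm hgm (memLp_mulVec (Vᵀ * M) hh) hx
  have hcross : ∫ ω, V *ᵥ (x ω - (P[x | m]) ω) ⬝ᵥ M *ᵥ (V *ᵥ (P[x | m]) ω + c ω) ∂P = 0 := by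
    rw [← h0]
    congr 1
    funext ω
    rw [mulVec_dotProduct, mulVec_mulVec, dotProduct_comm]
  have heq : ∀ ω, (V *ᵥ x ω + c ω) ⬝ᵥ M *ᵥ (V *ᵥ x ω + c ω) =
      V *ᵥ (x ω - (P[x | m]) ω) ⬝ᵥ M *ᵥ V *ᵥ (x ω - (P[x | m]) ω) +
      2 * (V *ᵥ (x ω - (P[x | m]) ω) ⬝ᵥ M *ᵥ (V *ᵥ (P[x | m]) ω + c ω)) +
      (V *ᵥ (P[x | m]) ω + c ω) ⬝ᵥ M *ᵥ (V *ᵥ (P[x | m]) ω + c ω) := by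
    intro ω
    rw [← quadForm_add hM]
    have : V *ᵥ x ω + c ω = V *ᵥ (x ω - (P[x | m]) ω) + (V *ᵥ (P[x | m]) ω + c ω) := by
      rw [mulVec_sub]; abel
    rw [this]
  simp only [heq]
  rw [integral_add, integral_add, integral_const_mul, hcross]
  · ring
  · exact integrable_quadForm M he he
  · exact (integrable_quadForm M he hh).const_mul 2
  · exact (integrable_quadForm M he he).add ((integrable_quadForm M he hh).const_mul 2)
  · exact integrable_quadForm M hh hh

/-- Mean square of the error of estimating `x` from `m`, weighted by `Vᵀ M V`. -/
noncomputable def errorOf (P : Measure Ω) (m : MeasurableSpace Ω) (M : Matrix (Fin a) (Fin a) ℝ)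
    (V : Matrix (Fin a) (Fin b) ℝ) (x : Ω → Fin b → ℝ) : ℝ :=
  ∫ ω, V *ᵥ (x ω - (P[x | m]) ω) ⬝ᵥ M *ᵥ V *ᵥ (x ω - (P[x | m]) ω) ∂P

/-- Pythagoras with the known part `V g`; the square of `V (E[x ∣ m] + g)` is dropped. -/
theorem errorOf_le (hm : m ≤ mΩ) {M : Matrix (Fin a) (Fin a) ℝ} (hM : M.PosSemidef)
    (V : Matrix (Fin a) (Fin b) ℝ) {x g : Ω → Fin b → ℝ} (hx : MemLp x 2 P)
    (hgm : Measurable[m] g) (hg : MemLp g 2 P) :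
    errorOf P m M V x ≤ ∫ ω, V *ᵥ (x ω + g ω) ⬝ᵥ M *ᵥ V *ᵥ (x ω + g ω) ∂P := by
  have hV : Measurable fun y : Fin b → ℝ => V *ᵥ y :=
    (LinearMap.toContinuousLinearMap V.mulVecLin).measurable
  have h := integral_quadForm_condExp hm (transpose_eq_of_posSemidef hM) V hx (hV.comp hgm)
    (memLp_mulVec V hg)
  simp only [Function.comp_apply, ← mulVec_add] at h
  rw [h]
  exact le_add_of_nonneg_right (integral_nonneg fun ω => quadForm_nonneg hM _)

/-- The estimate from `m` is one of the competitors available to `m'`. -/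
theorem errorOf_antitone {m' : MeasurableSpace Ω} (hmm : m ≤ m') (hm : m' ≤ mΩ)
    {M : Matrix (Fin a) (Fin a) ℝ} (hM : M.PosSemidef)
    (V : Matrix (Fin a) (Fin b) ℝ) {x : Ω → Fin b → ℝ} (hx : MemLp x 2 P) :
    errorOf P m' M V x ≤ errorOf P m M V x := by
  have h := errorOf_le hm hM V hx (g := fun ω => -(P[x | m]) ω)
    ((stronglyMeasurable_condExp.mono hmm).measurable.neg) (hx.condExp (by norm_num)).neg
  simpa only [← sub_eq_add_neg, errorOf] using h

end SquareIntegrable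

/-! ### Measurability tools and the ON times of a path -/

theorem measurable_snoc {α β : Type*} [MeasurableSpace α] {mβ : MeasurableSpace β} {k : ℕ}
    {f : β → Fin k → α} {g : β → α} (hf : Measurable f) (hg : Measurable g) :
    Measurable fun x => (Fin.snoc (f x) (g x) : Fin (k + 1) → α) := by
  refine measurable_pi_iff.2 fun i => ?_
  induction i using Fin.lastCases with
  | last => simpa using hg
  | cast i => simpa using (measurable_pi_iff.1 hf) i

theorem measurable_mulVec {a b : ℕ} (A : Matrix (Fin a) (Fin b) ℝ) :
    Measurable fun y : Fin b → ℝ => A *ᵥ y :=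
  (LinearMap.toContinuousLinearMap A.mulVecLin).measurable

/-- The fog state at time `k` on the path `t`. -/
def fogAt {N : ℕ} (t : Fin (N + 1) → Bool) (k : ℕ) : Bool :=
  if h : k < N + 1 then t ⟨k, h⟩ else false

/-- The times before `k` at which the path `t` is ON. -/
def onTimes {N : ℕ} (t : Fin (N + 1) → Bool) (k : ℕ) : Set ℕ := {i | i < k ∧ fogAt t i = true}

theorem onTimes_mono {N : ℕ} (t : Fin (N + 1) → Bool) {k l : ℕ} (h : k ≤ l) :
    onTimes t k ⊆ onTimes t l := fun _ hi => ⟨hi.1.trans_le h, hi.2⟩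

theorem onTimes_congr {N : ℕ} {t t' : Fin (N + 1) → Bool} {k : ℕ}
    (h : ∀ i < k, fogAt t i = fogAt t' i) : onTimes t k = onTimes t' k := by
  ext i
  exact and_congr_right fun hi => by rw [h i hi]

theorem onTimes_subset_of_le {N : ℕ} {t t' : Fin (N + 1) → Bool} (h : t ≤ t') (k : ℕ) :
    onTimes t k ⊆ onTimes t' k := by
  rintro i ⟨hi, hi'⟩
  refine ⟨hi, ?_⟩
  unfold fogAt at *
  split_ifs at * with h1
  exact h _ hi'

/-- Links the information in `H_k` on a path that is ON at `k` with the set used in `errorTerm`,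
which ignores the fog state at `k`. -/
theorem onTimes_succ_of_on {N : ℕ} {t : Fin (N + 1) → Bool} {k : ℕ} (h : fogAt t k = true) :
    onTimes t (k + 1) = insert k (onTimes t k) := by
  ext i
  simp only [onTimes, Set.mem_ofPred_eq, Set.mem_insert_iff]
  constructor
  · rintro ⟨h1, h2⟩
    rcases Nat.lt_succ_iff_lt_or_eq.1 h1 with h1 | h1
    · exact Or.inr ⟨h1, h2⟩
    · exact Or.inl h1
  · rintro (h1 | ⟨h1, h2⟩)
    · subst h1; exact ⟨Nat.lt_succ_self _, h⟩
    · exact ⟨h1.trans (Nat.lt_succ_self _), h2⟩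

namespace Plant

variable {n s m N : ℕ} {Ω : Type*} {mA : MeasurableSpace Ω} [mΩ : MeasurableSpace Ω] {P : Measure Ω}
  (S : Plant n s m N P) (π : Policy m s)

/-! ### Superposition, and the information revealed along a path -/

/-- The state of the uncontrolled system. -/
def free : ℕ → Ω → (Fin n → ℝ)
  | 0 => S.x₀
  | k + 1 => fun ω => S.A k *ᵥ free k ω + S.w k ω

/-- The channel output of the uncontrolled system. -/
def freeOutput (k : ℕ) (ω : Ω) : Fin m → ℝ := S.C k *ᵥ S.free k ω + S.v k ω

/-- The information carried by the uncontrolled outputs at the times in `T`. -/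
@[reducible]
def info (T : Set ℕ) : MeasurableSpace Ω :=
  ⨆ i ∈ T, MeasurableSpace.comap (S.freeOutput i) inferInstance

/-- The contribution of the first `k` control signals to the state at time `k`. -/
def shift : (k : ℕ) → (Fin k → (Fin s → ℝ)) → (Fin n → ℝ)
  | 0 => fun _ => 0
  | k + 1 => fun us => S.A k *ᵥ shift k (Fin.init us) + S.B k *ᵥ us (Fin.last k)

theorem measurable_shift (k : ℕ) : Measurable (S.shift k) := by
  induction k with
  | zero => exact measurable_const
  | succ k ih =>
    refine Measurable.add ?_ ?_
    · refine (measurable_mulVec _).comp (ih.comp ?_)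
      exact measurable_pi_iff.2 fun i => measurable_pi_apply _
    · exact (measurable_mulVec _).comp (measurable_pi_apply _)

/-- By linearity the controls enter the state additively, through a function of the past controls
alone. -/
theorem state_eq (k : ℕ) (y : Sample N Ω) :
    S.state π k y = S.free k y.2 + S.shift k (S.run π y k).2.2 := by
  induction k with
  | zero => simp [state, run, free, shift]
  | succ k ih =>
    unfold state at ih ⊢
    simp only [run, free, shift, Fin.init_snoc, Fin.snoc_last, ih, mulVec_add]
    abel

theorem reading_state_eq (k : ℕ) (t : Fin (N + 1) → Bool) (ω : Ω) :
    S.reading (t, ω) k (S.state π k (t, ω)) = if fogAt t k then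
      Sum.inr (S.freeOutput k ω + S.C k *ᵥ S.shift k (S.run π (t, ω) k).2.2) else Sum.inl () := by
  unfold reading
  rw [state_eq]
  simp only [freeOutput, mulVec_add]
  congr 2
  abel

theorem run_succ (k : ℕ) (y : Sample N Ω) :
    (S.run π y (k + 1)).2 = ((S.history π k y).1, Fin.snoc (S.run π y k).2.2 (S.control π k y)) :=
  rfl

theorem info_mono {T T' : Set ℕ} (h : T ⊆ T') : S.info T ≤ S.info T' :=
  biSup_mono h

theorem measurable_freeOutput_info {T : Set ℕ} {i : ℕ} (h : i ∈ T) :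
    Measurable[S.info T] (S.freeOutput i) := by
  refine Measurable.mono (comap_measurable (S.freeOutput i)) ?_ le_rfl
  exact le_iSup₂_of_le (f := fun i (_ : i ∈ T) => MeasurableSpace.comap (S.freeOutput i) _) i h le_rfl

section Measurability

variable {π}

theorem measurable_reading_of {k : ℕ} {t : Fin (N + 1) → Bool}
    (h1 : fogAt t k = true → Measurable[mA] (S.freeOutput k))
    (h2 : Measurable[mA] fun ω => (S.run π (t, ω) k).2) :
    Measurable[mA] fun ω => S.history π k (t, ω) := by
  have h3 : Measurable[mA] fun ω => (S.run π (t, ω) k).2.1 := measurable_fst.comp h2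
  have h4 : Measurable[mA] fun ω => (S.run π (t, ω) k).2.2 := measurable_snd.comp h2
  have h5 : Measurable[mA] fun ω => S.reading (t, ω) k (S.state π k (t, ω)) := by
    simp only [reading_state_eq]
    split_ifs with hf
    · exact measurable_inr.comp ((h1 hf).add ((measurable_mulVec _).comp
        ((S.measurable_shift k).comp h4)))
    · exact measurable_const
  exact (measurable_snoc h3 h5).prodMk h4

theorem measurable_control_of (hπ : Feasible N π) {k : ℕ} (hk : k < N)
    {t : Fin (N + 1) → Bool} (h : Measurable[mA] fun ω => S.history π k (t, ω)) :
    Measurable[mA] fun ω => S.control π k (t, ω) :=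
  ((hπ k hk).1 (fogAt t k)).comp h

/-- Induction on time: an OFF slot gives a constant reading, an ON slot the uncontrolled output plus
a function of earlier controls, and each control is a measurable function of the history. -/
theorem measurable_run_info (hπ : Feasible N π) (t : Fin (N + 1) → Bool) {k : ℕ} (hk : k ≤ N) :
    Measurable[S.info (onTimes t k)] fun ω => (S.run π (t, ω) k).2 := by
  induction k with
  | zero => exact measurable_const
  | succ k ih =>
    have ih' : Measurable[S.info (onTimes t (k + 1))] fun ω => (S.run π (t, ω) k).2 :=
      (ih (by omega)).mono (S.info_mono (onTimes_mono t (Nat.le_succ k))) le_rfl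
    have hh : Measurable[S.info (onTimes t (k + 1))] fun ω => S.history π k (t, ω) :=
      S.measurable_reading_of (fun hf => S.measurable_freeOutput_info ⟨Nat.lt_succ_self k, hf⟩) ih'
    simp only [run_succ]
    exact (measurable_fst.comp hh).prodMk
      (measurable_snoc (measurable_snd.comp ih') (S.measurable_control_of hπ hk hh))

theorem measurable_history_info (hπ : Feasible N π) (t : Fin (N + 1) → Bool) {k : ℕ} (hk : k < N) :
    Measurable[S.info (onTimes t (k + 1))] fun ω => S.history π k (t, ω) :=
  S.measurable_reading_of (fun hf => S.measurable_freeOutput_info ⟨Nat.lt_succ_self k, hf⟩)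
    ((S.measurable_run_info hπ t hk.le).mono (S.info_mono (onTimes_mono t (Nat.le_succ k))) le_rfl)

theorem measurable_control_info (hπ : Feasible N π) (t : Fin (N + 1) → Bool) {k : ℕ} (hk : k < N) :
    Measurable[S.info (onTimes t (k + 1))] fun ω => S.control π k (t, ω) :=
  S.measurable_control_of hπ hk (S.measurable_history_info hπ t hk)

theorem measurable_shift_run_info (hπ : Feasible N π) (t : Fin (N + 1) → Bool) {k : ℕ}
    (hk : k ≤ N) :
    Measurable[S.info (onTimes t k)] fun ω => S.shift k (S.run π (t, ω) k).2.2 :=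
  (S.measurable_shift k).comp (measurable_snd.comp (S.measurable_run_info hπ t hk))

theorem measurable_free {k : ℕ} (hk : k ≤ N) : Measurable (S.free k) := by
  induction k with
  | zero => exact S.measurable_x₀
  | succ k ih => exact ((measurable_mulVec _).comp (ih (by omega))).add (S.measurable_w k hk)

theorem measurable_freeOutput {k : ℕ} (hk : k < N) : Measurable (S.freeOutput k) :=
  ((measurable_mulVec _).comp (S.measurable_free hk.le)).add (S.measurable_v k hk)

theorem info_le {T : Set ℕ} (hT : ∀ i ∈ T, i < N) : S.info T ≤ mΩ :=
  iSup₂_le fun i hi => (S.measurable_freeOutput (hT i hi)).comap_le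

theorem info_onTimes_le (t : Fin (N + 1) → Bool) {k : ℕ} (hk : k ≤ N) :
    S.info (onTimes t k) ≤ mΩ :=
  S.info_le fun _ hi => hi.1.trans_le hk

theorem memLp_free {k : ℕ} (hk : k ≤ N) : MemLp (S.free k) 2 P := by
  induction k with
  | zero => exact S.memLp_x₀
  | succ k ih => exact (memLp_mulVec _ (ih (by omega))).add (S.memLp_w k hk)

end Measurability

/-! ### Recovering the uncontrolled history: no dual effect -/

/-- A reading, corrected for the contribution `d` of the controls to the state. -/
def correct (k : ℕ) (r : Reading m) (d : Fin n → ℝ) : Reading m :=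
  Sum.map id (fun z => z - S.C k *ᵥ d) r

/-- The uncontrolled readings, computed from the readings and controls. -/
def freeReadings : (k : ℕ) → (Fin k → Reading m) × (Fin k → (Fin s → ℝ)) → (Fin k → Reading m)
  | 0 => fun _ => Fin.elim0
  | k + 1 => fun h => Fin.snoc (freeReadings k (Fin.init h.1, Fin.init h.2))
      (S.correct k (h.1 (Fin.last k)) (S.shift k (Fin.init h.2)))

/-- The uncontrolled history, computed from the history. -/
def freeHistory (k : ℕ) (h : History m s k) : History m s k :=
  (Fin.snoc (S.freeReadings k (Fin.init h.1, h.2)) (S.correct k (h.1 (Fin.last k)) (S.shift k h.2)),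
    0)

theorem measurable_correct {α : Type*} [MeasurableSpace α] (k : ℕ) {f : α → Reading m}
    {g : α → Fin n → ℝ} (hf : Measurable f) (hg : Measurable g) :
    Measurable fun x => S.correct k (f x) (g x) := by
  have h1 : Measurable fun x : Unit × (Fin n → ℝ) => S.correct k (Sum.inl x.1) x.2 :=
    measurable_const (a := (Sum.inl () : Reading m))
  have h0 : Measurable fun x : (Fin m → ℝ) × (Fin n → ℝ) => x.1 - S.C k *ᵥ x.2 :=
    measurable_fst.sub ((measurable_mulVec _).comp measurable_snd)
  have h2 : Measurable fun x : (Fin m → ℝ) × (Fin n → ℝ) => S.correct k (Sum.inr x.1) x.2 :=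
    measurable_inr.comp h0
  have h3 := (h1.sumElim h2).comp
    (MeasurableEquiv.sumProdDistrib Unit (Fin m → ℝ) (Fin n → ℝ)).measurable
  have h4 : Measurable fun x : Reading m × (Fin n → ℝ) => S.correct k x.1 x.2 := by
    convert h3 using 1
    funext x
    rcases x with ⟨x | x, d⟩ <;> rfl
  have h5 : Measurable fun x => (f x, g x) := hf.prodMk hg
  simpa only [Function.comp_def] using h4.comp h5

theorem measurable_init {α : Type*} [MeasurableSpace α] (k : ℕ) :
    Measurable fun f : Fin (k + 1) → α => (Fin.init f : Fin k → α) :=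
  measurable_pi_iff.2 fun _ => measurable_pi_apply _

theorem measurable_freeReadings (k : ℕ) : Measurable (S.freeReadings k) := by
  induction k with
  | zero => exact measurable_const
  | succ k ih =>
    have h1 : Measurable fun h : (Fin (k + 1) → Reading m) × (Fin (k + 1) → (Fin s → ℝ)) =>
        (Fin.init h.1 : Fin k → Reading m) := (measurable_init k).comp measurable_fst
    have h2 : Measurable fun h : (Fin (k + 1) → Reading m) × (Fin (k + 1) → (Fin s → ℝ)) =>
        (Fin.init h.2 : Fin k → (Fin s → ℝ)) := (measurable_init k).comp measurable_snd
    have h3 : Measurable fun h : (Fin (k + 1) → Reading m) × (Fin (k + 1) → (Fin s → ℝ)) =>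
        S.freeReadings k (Fin.init h.1, Fin.init h.2) := ih.comp (h1.prodMk h2)
    have h4 : Measurable fun h : (Fin (k + 1) → Reading m) × (Fin (k + 1) → (Fin s → ℝ)) =>
        h.1 (Fin.last k) := measurable_fst.eval
    have h5 : Measurable fun h : (Fin (k + 1) → Reading m) × (Fin (k + 1) → (Fin s → ℝ)) =>
        S.shift k (Fin.init h.2) := (S.measurable_shift k).comp h2
    have h6 : Measurable fun h : (Fin (k + 1) → Reading m) × (Fin (k + 1) → (Fin s → ℝ)) =>
        S.correct k (h.1 (Fin.last k)) (S.shift k (Fin.init h.2)) :=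
      S.measurable_correct k h4 h5
    exact measurable_snoc h3 h6

theorem measurable_freeHistory (k : ℕ) : Measurable (S.freeHistory k) := by
  have h1 : Measurable fun h : History m s k => (Fin.init h.1 : Fin k → Reading m) :=
    (measurable_init k).comp measurable_fst
  have h2 : Measurable fun h : History m s k => S.freeReadings k (Fin.init h.1, h.2) :=
    (S.measurable_freeReadings k).comp (h1.prodMk measurable_snd)
  have h3 : Measurable fun h : History m s k => h.1 (Fin.last k) :=
    measurable_fst.eval
  have h4 : Measurable fun h : History m s k => S.shift k h.2 :=
    (S.measurable_shift k).comp measurable_snd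
  have h5 : Measurable fun h : History m s k => S.correct k (h.1 (Fin.last k)) (S.shift k h.2) :=
    S.measurable_correct k h3 h4
  exact (measurable_snoc h2 h5).prodMk measurable_const

/-- The policy that never controls. -/
def idle : Policy m s := fun _ _ _ => 0

theorem feasible_idle : Feasible N (idle : Policy m s) :=
  fun _ _ => ⟨fun _ => measurable_const, fun _ => rfl⟩

theorem run_idle_controls (k : ℕ) (y : Sample N Ω) : (S.run idle y k).2.2 = 0 := by
  induction k with
  | zero => exact Subsingleton.elim _ _
  | succ k ih =>
    rw [run_succ]
    funext i
    induction i using Fin.lastCases with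
    | last => simp [control, idle]
    | cast i => simp [ih]

theorem shift_zero (k : ℕ) : S.shift k 0 = 0 := by
  induction k with
  | zero => rfl
  | succ k ih =>
    have : (Fin.init (0 : Fin (k + 1) → (Fin s → ℝ)) : Fin k → (Fin s → ℝ)) = 0 := rfl
    simp [shift, this, ih]

theorem state_idle (k : ℕ) (y : Sample N Ω) : S.state idle k y = S.free k y.2 := by
  rw [state_eq, run_idle_controls, shift_zero, add_zero]

theorem correct_reading (k : ℕ) (y : Sample N Ω) :
    S.correct k (S.reading y k (S.state π k y)) (S.shift k (S.run π y k).2.2) =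
      S.reading y k (S.state idle k y) := by
  rw [state_idle, state_eq]
  unfold reading correct
  split_ifs
  · simp only [Sum.map_inr, mulVec_add]
    congr 1
    abel
  · rfl

theorem freeReadings_run (k : ℕ) (y : Sample N Ω) :
    S.freeReadings k (S.run π y k).2 = (S.run idle y k).2.1 := by
  induction k with
  | zero => rfl
  | succ k ih =>
    simp only [run_succ, history, freeReadings, Fin.init_snoc, Fin.snoc_last, correct_reading]
    rw [← ih]

/-- The history contains the controls, so their effect on every reading can be subtracted. What
remains is the history of the idle policy, whose control entries are 0. -/
theorem freeHistory_history (k : ℕ) (y : Sample N Ω) :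
    S.freeHistory k (S.history π k y) = S.history idle k y := by
  simp only [freeHistory, history, Fin.init_snoc, Fin.snoc_last, correct_reading,
    run_idle_controls]
  rw [← S.freeReadings_run π]

theorem run_idle_readings (k : ℕ) (y : Sample N Ω) (i : Fin k) :
    (S.run idle y k).2.1 i = S.reading y i (S.free i y.2) := by
  induction k with
  | zero => exact i.elim0
  | succ k ih =>
    rw [run_succ]
    induction i using Fin.lastCases with
    | last => simp [history, state_idle]
    | cast i => simp [history, ih]

theorem info_le_comap_history (t : Fin (N + 1) → Bool) (k : ℕ) :
    S.info (onTimes t (k + 1)) ≤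
      MeasurableSpace.comap (fun ω => S.history π k (t, ω)) inferInstance := by
  refine iSup₂_le fun i hi => ?_
  rw [← measurable_iff_comap_le]
  have h1 : Measurable (Sum.elim (fun _ => 0) id : Reading m → (Fin m → ℝ)) :=
    measurable_const.sumElim measurable_id
  have h2 : S.freeOutput i = fun ω => (Sum.elim (fun _ => 0) id : Reading m → (Fin m → ℝ))
      ((S.freeHistory k (S.history π k (t, ω))).1 ⟨i, hi.1⟩) := by
    funext ω
    rw [freeHistory_history]
    change _ = Sum.elim (fun _ => 0) id ((S.run idle (t, ω) (k + 1)).2.1 ⟨i, hi.1⟩)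
    rw [run_idle_readings]
    have : fog i (t, ω) = true := hi.2
    simp [reading, this, freeOutput]
  rw [h2]
  exact h1.comp ((measurable_pi_apply _).comp (measurable_fst.comp
    ((S.measurable_freeHistory k).comp (comap_measurable fun ω => S.history π k (t, ω)))))

/-- The right-hand side does not mention the policy: on a fixed path, no choice of controls makes
the history more informative. -/
theorem comap_history_eq {π} (hπ : Feasible N π) (t : Fin (N + 1) → Bool) {k : ℕ} (hk : k < N) :
    MeasurableSpace.comap (fun ω => S.history π k (t, ω)) inferInstance =
      S.info (onTimes t (k + 1)) :=
  le_antisymm (measurable_iff_comap_le.1 (S.measurable_history_info hπ t hk))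
    (S.info_le_comap_history π t k)

end Plant

namespace Plant

variable {n s m N : ℕ} {Ω : Type*} [mΩ : MeasurableSpace Ω] {P : Measure Ω}
  (S : Plant n s m N P) {π : Policy m s} {p q : ℝ} (τ₀ : Bool)

/-! ### The joint law as a finite mixture over fog paths -/

section Law

variable [IsProbabilityMeasure P]

/-- There are finitely many fog paths, so integrals and almost sure statements can be treated path
by path. -/
theorem law_eq : S.law p q τ₀ =
    ∑ t, ENNReal.ofReal (pathProb N p q τ₀ t) • P.map (Prod.mk t) := by
  ext A hA
  rw [law, Measure.prod_apply hA, fogLaw, lintegral_finsetSum_measure, Measure.finsetSum_apply]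
  refine Finset.sum_congr rfl fun t _ => ?_
  rw [lintegral_smul_measure, lintegral_dirac, Measure.smul_apply,
    Measure.map_apply measurable_prodMk_left hA]

theorem isFiniteMeasure_law : IsFiniteMeasure (S.law p q τ₀) := by
  refine ⟨?_⟩
  rw [law_eq, Measure.finsetSum_apply]
  refine ENNReal.sum_lt_top.2 fun t _ => ?_
  rw [Measure.smul_apply, smul_eq_mul]
  have : IsProbabilityMeasure (P.map (Prod.mk t)) :=
    Measure.isProbabilityMeasure_map measurable_prodMk_left.aemeasurable
  exact ENNReal.mul_lt_top ENNReal.ofReal_lt_top (measure_lt_top _ _)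

theorem lintegral_law (G : Sample N Ω → ℝ≥0∞) :
    ∫⁻ y, G y ∂(S.law p q τ₀) =
      ∑ t, ENNReal.ofReal (pathProb N p q τ₀ t) * ∫⁻ ω, G (t, ω) ∂P := by
  rw [law_eq, lintegral_finsetSum_measure]
  refine Finset.sum_congr rfl fun t _ => ?_
  rw [lintegral_smul_measure, (measurableEmbedding_prodMk_left t).lintegral_map, smul_eq_mul]

theorem ae_law_iff (hp : p ∈ Set.Icc (0 : ℝ) 1) (hq : q ∈ Set.Icc (0 : ℝ) 1)
    {R : Sample N Ω → Prop} :
    (∀ᵐ y ∂(S.law p q τ₀), R y) ↔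
      ∀ t, pathProb N p q τ₀ t ≠ 0 → ∀ᵐ ω ∂P, R (t, ω) := by
  rw [law_eq, ae_finsetSum_measure_iff]
  refine ⟨fun h t ht => ?_, fun h t _ => ?_⟩
  · have h' := h t (Finset.mem_univ _)
    have h0 : ENNReal.ofReal (pathProb N p q τ₀ t) ≠ 0 := by
      simpa using lt_of_le_of_ne (pathProb_nonneg hp hq τ₀ t) (Ne.symm ht)
    rwa [Measure.ae_ennreal_smul_measure_iff h0, (measurableEmbedding_prodMk_left t).ae_map_iff] at h'
  · by_cases ht : pathProb N p q τ₀ t = 0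
    · simp [ht]
    · exact Measure.ae_smul_measure
        ((measurableEmbedding_prodMk_left t).ae_map_iff.2 (h t ht)) _

theorem integrable_law_iff (hp : p ∈ Set.Icc (0 : ℝ) 1) (hq : q ∈ Set.Icc (0 : ℝ) 1)
    {E : Type*} [NormedAddCommGroup E] {G : Sample N Ω → E} :
    Integrable G (S.law p q τ₀) ↔
      ∀ t, pathProb N p q τ₀ t ≠ 0 → Integrable (fun ω => G (t, ω)) P := by
  rw [law_eq, integrable_finsetSum_measure]
  refine ⟨fun h t ht => ?_, fun h t _ => ?_⟩
  · have h' := h t (Finset.mem_univ _)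
    have h0 : ENNReal.ofReal (pathProb N p q τ₀ t) ≠ 0 := by
      simpa using lt_of_le_of_ne (pathProb_nonneg hp hq τ₀ t) (Ne.symm ht)
    rwa [integrable_smul_measure h0 ENNReal.ofReal_ne_top,
      (measurableEmbedding_prodMk_left t).integrable_map_iff] at h'
  · by_cases ht : pathProb N p q τ₀ t = 0
    · simp [ht]
    · exact ((measurableEmbedding_prodMk_left t).integrable_map_iff.2 (h t ht)).smul_measure
        ENNReal.ofReal_ne_top

theorem integral_law (hp : p ∈ Set.Icc (0 : ℝ) 1) (hq : q ∈ Set.Icc (0 : ℝ) 1)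
    {E : Type*} [NormedAddCommGroup E] [NormedSpace ℝ E] {G : Sample N Ω → E}
    (hG : Integrable G (S.law p q τ₀)) :
    ∫ y, G y ∂(S.law p q τ₀) = ∑ t, pathProb N p q τ₀ t • ∫ ω, G (t, ω) ∂P := by
  rw [law_eq, integrable_finsetSum_measure] at hG
  rw [law_eq, integral_finsetSum_measure hG]
  refine Finset.sum_congr rfl fun t _ => ?_
  rw [integral_smul_measure, (measurableEmbedding_prodMk_left t).integral_map,
    ENNReal.toReal_ofReal (pathProb_nonneg hp hq τ₀ t)]

end Law

/-! ### The conditional expectation given the history, path by path -/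

section Estimate

variable (π) in
theorem run_congr {t t' : Fin (N + 1) → Bool} {k : ℕ} (h : ∀ i < k, fogAt t i = fogAt t' i) (ω : Ω) :
    S.run π (t, ω) k = S.run π (t', ω) k := by
  induction k with
  | zero => rfl
  | succ k ih =>
    have ih' := ih fun i hi => h i (hi.trans (Nat.lt_succ_self k))
    have hk : fog k (t, ω) = fog k (t', ω) := h k (Nat.lt_succ_self k)
    simp only [run, ih', hk, reading]

variable (π) in
theorem state_congr {t t' : Fin (N + 1) → Bool} {k : ℕ} (h : ∀ i < k, fogAt t i = fogAt t' i)
    (ω : Ω) : S.state π k (t, ω) = S.state π k (t', ω) := by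
  rw [state, S.run_congr π h, state]

variable (π) in
theorem history_congr {t t' : Fin (N + 1) → Bool} {k : ℕ} (h : ∀ i ≤ k, fogAt t i = fogAt t' i)
    (ω : Ω) : S.history π k (t, ω) = S.history π k (t', ω) := by
  have hk : fog k (t, ω) = fog k (t', ω) := h k le_rfl
  simp only [history, state, S.run_congr π fun i hi => h i hi.le, reading, hk]

theorem measurable_history (hπ : Feasible N π) {k : ℕ} (hk : k < N) :
    Measurable (S.history π k) :=
  measurable_from_prod_countable_right fun t =>
    (S.measurable_history_info hπ t hk).mono (S.info_onTimes_le t hk) le_rfl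

/-- The ON/OFF pattern of a history. -/
def pattern {k : ℕ} (h : History m s k) (i : Fin (k + 1)) : Bool := (h.1 i).isRight

theorem measurable_pattern {k : ℕ} : Measurable (pattern : History m s k → _) := by
  have h1 : Measurable (Sum.isRight : Reading m → Bool) :=
    (measurable_const (a := false) (β := Unit)).sumElim
      (measurable_const (a := true) (β := Fin m → ℝ)) |> fun h => by
        convert h using 1
        funext x
        cases x <;> rfl
  refine measurable_pi_iff.2 fun i => ?_
  have h2 : Measurable fun h : History m s k => h.1 i := measurable_fst.eval
  simpa only [Function.comp_def, pattern] using h1.comp h2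

variable (π) in
theorem run_readings_isRight (y : Sample N Ω) {k : ℕ} (i : Fin k) :
    ((S.run π y k).2.1 i).isRight = fogAt y.1 i := by
  induction k with
  | zero => exact i.elim0
  | succ k ih =>
    rw [run_succ]
    induction i using Fin.lastCases with
    | last =>
      simp only [history, Fin.snoc_last, reading, Fin.val_last]
      change _ = fog k y
      split_ifs with h <;> simp [h]
    | cast i => simp [history, ih]

variable (π) in
theorem pattern_history (y : Sample N Ω) (k : ℕ) (i : Fin (k + 1)) :
    pattern (S.history π k y) i = fogAt y.1 i :=
  S.run_readings_isRight π y (k := k + 1) i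

variable [IsProbabilityMeasure P]

/-- Along a path of positive probability, the estimate is the conditional expectation given the
information that the path reveals. -/
theorem estimate_slice (hp : p ∈ Set.Icc (0 : ℝ) 1) (hq : q ∈ Set.Icc (0 : ℝ) 1)
    (hπ : Feasible N π) {k : ℕ} (hk : k < N)
    (hint : ∀ t, pathProb N p q τ₀ t ≠ 0 → Integrable (fun ω => S.state π k (t, ω)) P)
    {t : Fin (N + 1) → Bool} (ht : pathProb N p q τ₀ t ≠ 0) :
    (fun ω => S.estimate π p q τ₀ k (t, ω)) =ᵐ[P]
      P[fun ω => S.state π k (t, ω) | S.info (onTimes t (k + 1))] := by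
  have := S.isFiniteMeasure_law (p := p) (q := q) τ₀
  have hmeas := S.measurable_history hπ hk
  have hstate : Integrable (S.state π k) (S.law p q τ₀) :=
    (S.integrable_law_iff τ₀ hp hq).2 hint
  have hest : Integrable (S.estimate π p q τ₀ k) (S.law p q τ₀) := integrable_condExp
  have hest' := (S.integrable_law_iff τ₀ hp hq).1 hest
  obtain ⟨g, hg, hgE⟩ := (stronglyMeasurable_condExp (μ := S.law p q τ₀) (f := S.state π k)
    (m := MeasurableSpace.comap (S.history π k) inferInstance)).exists_eq_measurable_comp
  have hE : S.estimate π p q τ₀ k = g ∘ S.history π k := hgE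
  rw [← S.comap_history_eq hπ t hk]
  have hslice : Measurable fun ω => S.history π k (t, ω) := hmeas.comp measurable_prodMk_left
  refine ae_eq_condExp_of_forall_setIntegral_eq hslice.comap_le (hint t ht)
    (fun _ _ _ => (hest' t ht).integrableOn) ?_ ?_
  · rintro _ ⟨U, hU, rfl⟩ -
    -- A history records which slots were ON, so this intersection isolates the paths that agree
    -- with `t` up to time `k`.
    set W : Set (History m s k) := U ∩ pattern ⁻¹' {fun i : Fin (k + 1) => fogAt t i}
    have hW : MeasurableSet W := hU.inter (measurable_pattern (measurableSet_singleton _))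
    have hA : MeasurableSet (S.history π k ⁻¹' W) := hmeas hW
    have key := setIntegral_condExp hmeas.comap_le hstate (s := S.history π k ⁻¹' W) ⟨W, hW, rfl⟩
    -- All paths that contribute carry the same integrand, so the integral is that of the slice at
    -- `t` times the total probability of these paths. That probability is positive because `t` is
    -- among them, and it cancels.
    have slice : ∀ F : Sample N Ω → (Fin n → ℝ), Integrable F (S.law p q τ₀) →
        (∀ t', (∀ i ≤ k, fogAt t' i = fogAt t i) → ∀ ω, F (t', ω) = F (t, ω)) →
        ∫ y in S.history π k ⁻¹' W, F y ∂(S.law p q τ₀) =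
          (∑ t', if ∀ i ≤ k, fogAt t' i = fogAt t i then pathProb N p q τ₀ t' else 0) •
            ∫ ω in (fun ω => S.history π k (t, ω)) ⁻¹' U, F (t, ω) ∂P := by
      intro F hF hF'
      rw [← integral_indicator hA, S.integral_law τ₀ hp hq (hF.indicator hA), Finset.sum_smul]
      refine Finset.sum_congr rfl fun t' _ => ?_
      split_ifs with htt
      · rw [← integral_indicator (hslice hU)]
        congr 2
        funext ω
        have h1 := S.history_congr π htt ω
        have h2 : pattern (S.history π k (t, ω)) = fun i : Fin (k + 1) => fogAt t i :=
          funext fun i => S.pattern_history π (t, ω) k i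
        have h3 : (t', ω) ∈ S.history π k ⁻¹' W ↔ ω ∈ (fun ω => S.history π k (t, ω)) ⁻¹' U := by
          rw [Set.mem_preimage, h1]
          exact ⟨fun h => h.1, fun h => ⟨h, h2⟩⟩
        by_cases h4 : ω ∈ (fun ω => S.history π k (t, ω)) ⁻¹' U
        · rw [Set.indicator_of_mem (h3.2 h4), Set.indicator_of_mem h4, hF' t' htt]
        · rw [Set.indicator_of_notMem (fun h => h4 (h3.1 h)), Set.indicator_of_notMem h4]
      · rw [zero_smul]
        have : ∀ ω, (S.history π k ⁻¹' W).indicator F (t', ω) = 0 := by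
          intro ω
          refine Set.indicator_of_notMem (fun hmem => htt fun i hi => ?_) _
          have := congrFun (Set.mem_singleton_iff.1 hmem.2) ⟨i, Nat.lt_succ_iff.2 hi⟩
          rwa [S.pattern_history π (t', ω) k] at this
        simp [this]
    have hpos : (∑ t', if ∀ i ≤ k, fogAt t' i = fogAt t i then pathProb N p q τ₀ t' else 0) ≠ 0 := by
      refine ne_of_gt (Finset.sum_pos' (fun t' _ => ?_) ⟨t, Finset.mem_univ _, ?_⟩)
      · split_ifs
        · exact pathProb_nonneg hp hq _ _
        · exact le_rfl
      · simpa using lt_of_le_of_ne (pathProb_nonneg hp hq τ₀ t) (Ne.symm ht)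
    change ∫ y in _, S.estimate π p q τ₀ k y ∂_ = _ at key
    rw [slice _ hest fun t' h ω => by
        rw [hE, Function.comp_apply, Function.comp_apply, S.history_congr π h],
      slice _ hstate fun t' h ω => S.state_congr π (fun i hi => h i hi.le) ω] at key
    exact smul_right_injective _ hpos key
  · rw [hE]
    have : StronglyMeasurable[MeasurableSpace.comap (fun ω => S.history π k (t, ω)) inferInstance]
        fun ω => g (S.history π k (t, ω)) :=
      hg.comp_measurable (comap_measurable fun ω => S.history π k (t, ω))
    exact this.aestronglyMeasurable

end Estimate

end Plant

/-! ### Independence of a disturbance from the past -/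

/-- The two hypotheses make the joint probability factor over all three variables on boxes, and
boxes determine the joint law. -/
theorem indepFun_prodMk_of_indepFun {Ω α β γ : Type*} [MeasurableSpace Ω] {P : Measure Ω}
    [IsProbabilityMeasure P] [MeasurableSpace α] [MeasurableSpace β] [MeasurableSpace γ]
    {X : Ω → α} {Y : Ω → β} {Z : Ω → γ} (hX : Measurable X) (hY : Measurable Y) (hZ : Measurable Z)
    (h : IndepFun X (fun ω => (Y ω, Z ω)) P) (h' : IndepFun Y Z P) :
    IndepFun Y (fun ω => (X ω, Z ω)) P := by
  have hXZ : IndepFun X Z P := h.comp measurable_id measurable_snd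
  have := Measure.isProbabilityMeasure_map (μ := P) hX.aemeasurable
  have := Measure.isProbabilityMeasure_map (μ := P) hY.aemeasurable
  have := Measure.isProbabilityMeasure_map (μ := P) hZ.aemeasurable
  have := Measure.isProbabilityMeasure_map (μ := P) (hX.prodMk hZ).aemeasurable
  have := Measure.isProbabilityMeasure_map (μ := P) (hY.prodMk (hX.prodMk hZ)).aemeasurable
  rw [indepFun_iff_map_prod_eq_prod_map_map hY.aemeasurable (hX.prodMk hZ).aemeasurable]
  refine Measure.ext_prod₃ fun {s t u} hs ht hu => ?_
  rw [Measure.map_apply (hY.prodMk (hX.prodMk hZ)) (hs.prod (ht.prod hu)), Measure.prod_prod,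
    Measure.map_apply hY hs, Measure.map_apply (hX.prodMk hZ) (ht.prod hu)]
  have e1 : (fun ω => (Y ω, X ω, Z ω)) ⁻¹' s ×ˢ t ×ˢ u =
      X ⁻¹' t ∩ (fun ω => (Y ω, Z ω)) ⁻¹' s ×ˢ u := by
    ext ω; simp only [Set.mem_preimage, Set.mem_prod, Set.mem_inter_iff]; tauto
  have e2 : (fun ω => (Y ω, Z ω)) ⁻¹' s ×ˢ u = Y ⁻¹' s ∩ Z ⁻¹' u := by
    ext ω; simp
  have e3 : (fun ω => (X ω, Z ω)) ⁻¹' t ×ˢ u = X ⁻¹' t ∩ Z ⁻¹' u := by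
    ext ω; simp
  rw [e1, h.measure_inter_preimage_eq_mul _ _ ht (hs.prod hu), e2,
    h'.measure_inter_preimage_eq_mul _ _ hs hu, e3, hXZ.measure_inter_preimage_eq_mul _ _ ht hu]
  ring

namespace Plant

variable {n s m N : ℕ} {Ω : Type*} [mΩ : MeasurableSpace Ω] {P : Measure Ω}
  (S : Plant n s m N P) {π : Policy m s}

section Noise

/-- The initial state, the measurement noises, and the disturbances before time `k`. -/
def pastNoise (k : ℕ) (ω : Ω) : (Fin n → ℝ) × (Fin N → (Fin m → ℝ)) × (Fin k → (Fin n → ℝ)) :=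
  (S.x₀ ω, fun j => S.v j ω, fun i => S.w i ω)

/-- One block is added at a time: the earlier disturbances, then the measurement noises, then the
initial state. -/
theorem indepFun_pastNoise [IsProbabilityMeasure P] {k : ℕ} (hk : k < N) :
    IndepFun (S.w k) (S.pastNoise k) P := by
  have hw := S.measurable_w k hk
  have hW : Measurable fun ω => fun i : Fin k => S.w i ω :=
    measurable_pi_iff.2 fun i : Fin k => S.measurable_w i (i.2.trans hk)
  have hV : Measurable fun ω => fun j : Fin N => S.v j ω :=
    measurable_pi_iff.2 fun j : Fin N => S.measurable_v j j.2
  have h1 : IndepFun (S.w k) (fun ω => fun i : Fin k => S.w i ω) P := by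
    have h := S.iIndep_w.indepFun_finset {⟨k, hk⟩} (Finset.univ.filter fun i : Fin N => (i : ℕ) < k)
      (by simp) fun i => S.measurable_w i i.2
    have hφ : Measurable fun f : ({⟨k, hk⟩} : Finset (Fin N)) → (Fin n → ℝ) =>
        f ⟨⟨k, hk⟩, by simp⟩ := measurable_pi_apply _
    have hψ : Measurable fun f : (Finset.univ.filter fun i : Fin N => (i : ℕ) < k) →
        (Fin n → ℝ) => fun i : Fin k => f ⟨⟨i, i.2.trans hk⟩, by simp⟩ :=
      measurable_pi_iff.2 fun _ => measurable_pi_apply _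
    exact h.comp hφ hψ
  have hsplit : Measurable fun f : Fin N → (Fin n → ℝ) =>
      (f ⟨k, hk⟩, fun i : Fin k => f ⟨i, i.2.trans hk⟩) :=
    (measurable_pi_apply _).prodMk (measurable_pi_iff.2 fun _ => measurable_pi_apply _)
  have h2 : IndepFun (S.w k) (fun ω => ((fun j : Fin N => S.v j ω), fun i : Fin k => S.w i ω)) P :=
    indepFun_prodMk_of_indepFun hV hw hW (S.indep_w_v.symm.comp measurable_id hsplit) h1
  have hsplit2 : Measurable fun f : (Fin N → (Fin n → ℝ)) × (Fin N → (Fin m → ℝ)) =>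
      (f.1 ⟨k, hk⟩, f.2, fun i : Fin k => f.1 ⟨i, i.2.trans hk⟩) :=
    measurable_fst.eval.prodMk (measurable_snd.prodMk
      (measurable_pi_iff.2 fun _ => measurable_fst.eval))
  exact indepFun_prodMk_of_indepFun S.measurable_x₀ hw (hV.prodMk hW)
    (S.indep_x₀.comp measurable_id hsplit2) h2

theorem measurable_free_pastNoise {k i : ℕ} (hi : i ≤ k) :
    Measurable[MeasurableSpace.comap (S.pastNoise k) inferInstance] (S.free i) := by
  have hc : Measurable[MeasurableSpace.comap (S.pastNoise k) inferInstance] (S.pastNoise k) :=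
    comap_measurable _
  induction i with
  | zero => exact measurable_fst.comp hc
  | succ i ih =>
    have h1 : Measurable[MeasurableSpace.comap (S.pastNoise k) inferInstance] (S.w i) :=
      (measurable_pi_apply (⟨i, hi⟩ : Fin k)).comp (measurable_snd.comp (measurable_snd.comp hc))
    exact ((measurable_mulVec _).comp (ih (by omega))).add h1

theorem info_le_pastNoise {T : Set ℕ} {k : ℕ} (hk : k < N) (hT : ∀ i ∈ T, i ≤ k) :
    S.info T ≤ MeasurableSpace.comap (S.pastNoise k) inferInstance := by
  refine iSup₂_le fun i hi => ?_
  rw [← measurable_iff_comap_le]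
  have hc : Measurable[MeasurableSpace.comap (S.pastNoise k) inferInstance] (S.pastNoise k) :=
    comap_measurable _
  have h1 : Measurable[MeasurableSpace.comap (S.pastNoise k) inferInstance] (S.v i) :=
    (measurable_pi_apply (⟨i, (hT i hi).trans_lt hk⟩ : Fin N)).comp
      (measurable_fst.comp (measurable_snd.comp hc))
  exact ((measurable_mulVec _).comp (S.measurable_free_pastNoise (hT i hi))).add h1

theorem integral_disturbance_dotProduct [IsProbabilityMeasure P] {k : ℕ} (hk : k < N)
    {g : Ω → Fin n → ℝ} (hg : Measurable[MeasurableSpace.comap (S.pastNoise k) inferInstance] g)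
    (hg2 : MemLp g 2 P) : ∫ ω, S.w k ω ⬝ᵥ g ω ∂P = 0 := by
  obtain ⟨f, hf, rfl⟩ := hg.exists_eq_measurable_comp
  have hi := (S.indepFun_pastNoise hk).comp measurable_id hf
  unfold dotProduct
  rw [integral_finsetSum]
  · refine Finset.sum_eq_zero fun i _ => ?_
    have h1 : IndepFun (fun ω => S.w k ω i) (fun ω => (f ∘ S.pastNoise k) ω i) P :=
      hi.comp (measurable_pi_apply i) (measurable_pi_apply i)
    have h2 := h1.integral_mul_eq_mul_integral ((S.memLp_w k hk).eval i).aestronglyMeasurable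
      (hg2.eval i).aestronglyMeasurable
    have h3 : ∫ ω, S.w k ω i ∂P = 0 := by
      rw [← eval_integral fun i => ((S.memLp_w k hk).eval i).integrable (by norm_num), S.mean_w k hk]
      rfl
    rw [h3, zero_mul] at h2
    exact h2
  · intro i _
    exact ((S.memLp_w k hk).eval i).integrable_mul (hg2.eval i)

end Noise

/-! ### The Riccati recursion with ON probability `r` -/

section Riccati

/-- The Riccati matrix `K_k` of the symmetric case with ON probability `r`. -/
noncomputable def riccati (r : ℝ) (k : ℕ) : Matrix (Fin n) (Fin n) ℝ := S.riccatiBack r (N - k)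

/-- The weight `R_k + B_kᵀ K_{k+1} B_k` of deviations from the optimal control. -/
noncomputable def weight (r : ℝ) (k : ℕ) : Matrix (Fin s) (Fin s) ℝ :=
  S.R k + (S.B k)ᵀ * S.riccati r (k + 1) * S.B k

theorem riccati_horizon (r : ℝ) : S.riccati r N = S.Q N := by
  simp [riccati, riccatiBack]

theorem riccati_eq (r : ℝ) {k : ℕ} (hk : k < N) :
    S.riccati r k = S.riccatiStep r k (S.riccati r (k + 1)) := by
  have h1 : N - k = (N - (k + 1)) + 1 := by omega
  have h2 : N - ((N - (k + 1)) + 1) = k := by omega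
  rw [riccati, h1, riccatiBack, h2, riccati]

theorem gain_eq (r : ℝ) (k : ℕ) : S.gain r k = S.gainOf k (S.riccati r (k + 1)) := rfl

variable {r : ℝ}

theorem weight_mul_gain {k : ℕ} (hk : k < N) (hK : (S.riccati r (k + 1)).PosSemidef) :
    S.weight r k * S.gain r k = (S.B k)ᵀ * S.riccati r (k + 1) * S.A k := by
  have h := posDef_add_conj (B := S.B k) hK (S.posDef_R k hk)
  rw [gain_eq, gainOf, weight, ← Matrix.mul_assoc, ← Matrix.mul_assoc, ← Matrix.mul_assoc,
    mul_nonsing_inv _ ((isUnit_iff_isUnit_det _).1 h.isUnit), Matrix.one_mul]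

/-- Completing the square would subtract the whole square of `V_k x`, whereas the Riccati step
subtracts only the fraction `r` of it; the last term accounts for the rest. -/
theorem quadForm_riccati {k : ℕ} (hk : k < N) (hK : (S.riccati r (k + 1)).PosSemidef)
    (x : Fin n → ℝ) (u : Fin s → ℝ) :
    (S.A k *ᵥ x + S.B k *ᵥ u) ⬝ᵥ S.riccati r (k + 1) *ᵥ (S.A k *ᵥ x + S.B k *ᵥ u) +
      (x ⬝ᵥ S.Q k *ᵥ x + u ⬝ᵥ S.R k *ᵥ u) =
      x ⬝ᵥ S.riccati r k *ᵥ x +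
        (S.gain r k *ᵥ x + u) ⬝ᵥ S.weight r k *ᵥ (S.gain r k *ᵥ x + u) -
        (1 - r) * (S.gain r k *ᵥ x ⬝ᵥ S.weight r k *ᵥ S.gain r k *ᵥ x) := by
  have hK' := transpose_eq_of_posSemidef hK
  have hR := transpose_eq_of_posSemidef (S.posDef_R k hk).posSemidef
  have hV := S.weight_mul_gain hk hK
  have h1 := complete_square hK' hR hV x u
  have h2 := complete_square_zero hK' hR hV x
  rw [S.riccati_eq r hk, riccatiStep, ← gain_eq, sub_mulVec, add_mulVec, smul_mulVec,
    dotProduct_sub, dotProduct_add, dotProduct_smul, smul_eq_mul]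
  unfold weight at *
  rw [h2] at h1 ⊢
  linarith

/-- For the control `-V_k x` the deviation in `quadForm_riccati` vanishes, which leaves the form of
`K_k` as a sum of nonnegative costs and `1 - r` times a square. -/
theorem riccati_posSemidef (hr : r ∈ Set.Icc (0 : ℝ) 1) {k : ℕ} (hk : k ≤ N) :
    (S.riccati r k).PosSemidef := by
  induction hk using Nat.decreasingInduction with
  | self => rw [riccati_horizon]; exact S.posSemidef_Q N le_rfl
  | of_succ k hk hK =>
    have hKt := transpose_eq_of_posSemidef hK
    have hM := posDef_add_conj (B := S.B k) hK (S.posDef_R k hk)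
    refine PosSemidef.of_dotProduct_mulVec_nonneg ?_ fun x => ?_
    · have hQ := transpose_eq_of_posSemidef (S.posSemidef_Q k hk.le)
      have hMt : (S.weight r k)ᵀ = S.weight r k := transpose_eq_of_posSemidef hM.posSemidef
      have hV := S.weight_mul_gain hk hK
      have hV' : (S.A k)ᵀ * S.riccati r (k + 1) * S.B k = (S.gain r k)ᵀ * S.weight r k := by
        have := congrArg transpose hV
        rw [transpose_mul, hMt] at this
        rw [this]
        simp only [transpose_mul, transpose_transpose, hKt, Matrix.mul_assoc]
      rw [IsHermitian, conjTranspose_eq_transpose_of_trivial, S.riccati_eq r hk, riccatiStep,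
        ← gain_eq, hV']
      simp only [transpose_sub, transpose_add, transpose_smul, transpose_mul, transpose_transpose,
        hKt, hQ, hMt, Matrix.mul_assoc]
    · have h := S.quadForm_riccati hk hK x (-(S.gain r k *ᵥ x))
      have h1 := quadForm_nonneg hK (S.A k *ᵥ x + S.B k *ᵥ (-(S.gain r k *ᵥ x)))
      have h2 := quadForm_nonneg (S.posSemidef_Q k hk.le) x
      have h3 := quadForm_nonneg (S.posDef_R k hk).posSemidef (-(S.gain r k *ᵥ x))
      have h4 : 0 ≤ S.gain r k *ᵥ x ⬝ᵥ S.weight r k *ᵥ S.gain r k *ᵥ x :=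
        quadForm_nonneg hM.posSemidef _
      rw [add_neg_cancel, zero_dotProduct] at h
      have h5 := mul_nonneg (sub_nonneg.2 hr.2) h4
      rw [star_trivial]
      linarith

theorem weight_posSemidef (hr : r ∈ Set.Icc (0 : ℝ) 1) {k : ℕ} (hk : k < N) :
    (S.weight r k).PosSemidef :=
  (posDef_add_conj (S.riccati_posSemidef hr hk) (S.posDef_R k hk)).posSemidef

end Riccati

end Plant

/-! ### Exact cost decomposition along one fog path -/

namespace Plant

variable {n s m N : ℕ} {Ω : Type*} [mΩ : MeasurableSpace Ω] {P : Measure Ω}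
  (S : Plant n s m N P) (π : Policy m s) (r : ℝ) (k : ℕ) (t : Fin (N + 1) → Bool)

/-- Mean cost of the disturbance at time `k`. -/
noncomputable def noiseTerm : ℝ := ∫ ω, S.w k ω ⬝ᵥ S.riccati r (k + 1) *ᵥ S.w k ω ∂P

/-- Mean square of `V_k x_k` along the path `t`. -/
noncomputable def stateTerm : ℝ :=
  ∫ ω, S.gain r k *ᵥ S.state π k (t, ω) ⬝ᵥ S.weight r k *ᵥ S.gain r k *ᵥ S.state π k (t, ω) ∂P

/-- Mean square of the deviation of the control from `-V_k x_k` along the path `t`. -/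
noncomputable def deviationTerm : ℝ :=
  ∫ ω, (S.gain r k *ᵥ S.state π k (t, ω) + S.control π k (t, ω)) ⬝ᵥ
    S.weight r k *ᵥ (S.gain r k *ᵥ S.state π k (t, ω) + S.control π k (t, ω)) ∂P

/-- Mean square of the estimation error at time `k` if the path `t` is ON at that time. -/
noncomputable def errorTerm : ℝ :=
  errorOf P (S.info (insert k (onTimes t k))) (S.weight r k) (S.gain r k) (S.free k)

/-- The estimate of `x_k` from the information revealed along the path `t`. -/
noncomputable def pathEstimate (ω : Ω) : Fin n → ℝ :=
  (P[S.free k | S.info (onTimes t (k + 1))]) ω + S.shift k (S.run π (t, ω) k).2.2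

/-- Mean square of the deviation of the control from `-V_k E[x_k ∣ H_k]` along the path `t`. -/
noncomputable def gapTerm : ℝ :=
  ∫ ω, (S.gain r k *ᵥ S.pathEstimate π k t ω + S.control π k (t, ω)) ⬝ᵥ
    S.weight r k *ᵥ (S.gain r k *ᵥ S.pathEstimate π k t ω + S.control π k (t, ω)) ∂P

variable {π r k t}

theorem state_succ (y : Sample N Ω) : S.state π (k + 1) y =
    S.A k *ᵥ S.state π k y + S.B k *ᵥ S.control π k y + S.w k y.2 := rfl

theorem control_eq_zero (hπ : Feasible N π) (hk : k < N) (ht : fogAt t k = false) (ω : Ω) :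
    S.control π k (t, ω) = 0 := by
  have : fog k (t, ω) = false := ht
  rw [control, this]
  exact (hπ k hk).2 _

theorem memLp_state (h : ∀ j < k, MemLp (fun ω => S.control π j (t, ω)) 2 P) (hk : k ≤ N) :
    MemLp (fun ω => S.state π k (t, ω)) 2 P := by
  induction k with
  | zero => exact S.memLp_x₀
  | succ k ih =>
    simp only [state_succ]
    exact ((memLp_mulVec _ (ih (fun j hj => h j (hj.trans (Nat.lt_succ_self k))) (by omega))).add
      (memLp_mulVec _ (h k (Nat.lt_succ_self k)))).add (S.memLp_w k hk)

theorem memLp_shift_run (h : ∀ j < k, MemLp (fun ω => S.control π j (t, ω)) 2 P) (hk : k ≤ N) :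
    MemLp (fun ω => S.shift k (S.run π (t, ω) k).2.2) 2 P := by
  have h1 : (fun ω => S.shift k (S.run π (t, ω) k).2.2) =
      (fun ω => S.state π k (t, ω)) - S.free k := by
    funext ω
    simp [state_eq]
  rw [h1]
  exact (S.memLp_state h hk).sub (S.memLp_free hk)

theorem measurable_state_pastNoise (hπ : Feasible N π) (hk : k < N) :
    Measurable[MeasurableSpace.comap (S.pastNoise k) inferInstance]
      fun ω => S.state π k (t, ω) := by
  simp only [state_eq]
  exact (S.measurable_free_pastNoise le_rfl).add
    ((S.measurable_shift_run_info hπ t hk.le).mono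
      (S.info_le_pastNoise hk fun i hi => hi.1.le) le_rfl)

theorem measurable_control_pastNoise (hπ : Feasible N π) (hk : k < N) :
    Measurable[MeasurableSpace.comap (S.pastNoise k) inferInstance]
      fun ω => S.control π k (t, ω) :=
  (S.measurable_control_info hπ t hk).mono
    (S.info_le_pastNoise hk fun _ hi => Nat.lt_succ_iff.1 hi.1) le_rfl

theorem integrable_totalCost (h : ∀ j < N, MemLp (fun ω => S.control π j (t, ω)) 2 P) :
    Integrable (fun ω => S.totalCost π (t, ω)) P := by
  have hx : ∀ k ≤ N, MemLp (fun ω => S.state π k (t, ω)) 2 P := fun k hk =>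
    S.memLp_state (fun j hj => h j (hj.trans_le hk)) hk
  refine (integrable_quadForm _ (hx N le_rfl) (hx N le_rfl)).add
    (integrable_finsetSum _ fun k hk => ?_)
  have hk' := Finset.mem_range.1 hk
  exact (integrable_quadForm _ (hx k hk'.le) (hx k hk'.le)).add
    (integrable_quadForm _ (h k hk') (h k hk'))

theorem gapTerm_nonneg (hr : r ∈ Set.Icc (0 : ℝ) 1) (hk : k < N) : 0 ≤ S.gapTerm π r k t :=
  integral_nonneg fun _ => quadForm_nonneg (S.weight_posSemidef hr hk) _

variable [IsProbabilityMeasure P]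

/-- The next state is `A_k x_k + B_k u_k` plus the disturbance. `quadForm_riccati` handles the first
part, and the cross term has mean zero since `x_k` and `u_k` are functions of `pastNoise`. -/
theorem integral_step (hr : r ∈ Set.Icc (0 : ℝ) 1) (hπ : Feasible N π) (hk : k < N)
    (h : ∀ j < k + 1, MemLp (fun ω => S.control π j (t, ω)) 2 P) :
    ∫ ω, S.state π (k + 1) (t, ω) ⬝ᵥ S.riccati r (k + 1) *ᵥ S.state π (k + 1) (t, ω) ∂P +
      ∫ ω, (S.state π k (t, ω) ⬝ᵥ S.Q k *ᵥ S.state π k (t, ω) +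
        S.control π k (t, ω) ⬝ᵥ S.R k *ᵥ S.control π k (t, ω)) ∂P =
      ∫ ω, S.state π k (t, ω) ⬝ᵥ S.riccati r k *ᵥ S.state π k (t, ω) ∂P +
        (S.deviationTerm π r k t - (1 - r) * S.stateTerm π r k t + S.noiseTerm r k) := by
  have hK := S.riccati_posSemidef hr (Nat.succ_le_of_lt hk)
  have hx := S.memLp_state (fun j hj => h j (hj.trans (Nat.lt_succ_self k))) hk.le
  have hu := h k (Nat.lt_succ_self k)
  have hx' := S.memLp_state h hk
  have hw := S.memLp_w k hk
  have hz := (memLp_mulVec (S.A k) hx).add (memLp_mulVec (S.B k) hu)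
  have hVx := memLp_mulVec (S.gain r k) hx
  have hd := hVx.add hu
  have hcross : ∫ ω, S.w k ω ⬝ᵥ S.riccati r (k + 1) *ᵥ
      (S.A k *ᵥ S.state π k (t, ω) + S.B k *ᵥ S.control π k (t, ω)) ∂P = 0 := by
    refine S.integral_disturbance_dotProduct hk ?_ (memLp_mulVec _ hz)
    exact (measurable_mulVec _).comp
      (((measurable_mulVec _).comp (S.measurable_state_pastNoise hπ hk)).add
        ((measurable_mulVec _).comp (S.measurable_control_pastNoise hπ hk)))
  have hpt : ∀ ω, S.state π (k + 1) (t, ω) ⬝ᵥ S.riccati r (k + 1) *ᵥ S.state π (k + 1) (t, ω) +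
      (S.state π k (t, ω) ⬝ᵥ S.Q k *ᵥ S.state π k (t, ω) +
        S.control π k (t, ω) ⬝ᵥ S.R k *ᵥ S.control π k (t, ω)) =
      S.state π k (t, ω) ⬝ᵥ S.riccati r k *ᵥ S.state π k (t, ω) +
      ((S.gain r k *ᵥ S.state π k (t, ω) + S.control π k (t, ω)) ⬝ᵥ
        S.weight r k *ᵥ (S.gain r k *ᵥ S.state π k (t, ω) + S.control π k (t, ω)) -
      (1 - r) * (S.gain r k *ᵥ S.state π k (t, ω) ⬝ᵥ
        S.weight r k *ᵥ S.gain r k *ᵥ S.state π k (t, ω)) +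
      (2 * (S.w k ω ⬝ᵥ S.riccati r (k + 1) *ᵥ
        (S.A k *ᵥ S.state π k (t, ω) + S.B k *ᵥ S.control π k (t, ω))) +
      S.w k ω ⬝ᵥ S.riccati r (k + 1) *ᵥ S.w k ω)) := by
    intro ω
    have hKt := transpose_eq_of_posSemidef hK
    have h1 := S.quadForm_riccati hk hK (S.state π k (t, ω)) (S.control π k (t, ω))
    rw [state_succ, quadForm_add hKt, dotProduct_mulVec_comm hKt _ (S.w k (t, ω).2)]
    linarith
  have i1 : Integrable (fun ω => S.state π (k + 1) (t, ω) ⬝ᵥ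
      S.riccati r (k + 1) *ᵥ S.state π (k + 1) (t, ω)) P := integrable_quadForm _ hx' hx'
  have i2 : Integrable (fun ω => S.state π k (t, ω) ⬝ᵥ S.Q k *ᵥ S.state π k (t, ω) +
      S.control π k (t, ω) ⬝ᵥ S.R k *ᵥ S.control π k (t, ω)) P :=
    (integrable_quadForm _ hx hx).add (integrable_quadForm _ hu hu)
  have i3 := integrable_quadForm (S.riccati r k) hx hx
  have i4 := integrable_quadForm (S.weight r k) hd hd
  have i5 := (integrable_quadForm (S.weight r k) hVx hVx).const_mul (1 - r)
  have i6 := (integrable_quadForm (S.riccati r (k + 1)) hw hz).const_mul 2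
  have i7 := integrable_quadForm (S.riccati r (k + 1)) hw hw
  rw [← integral_add i1 i2]
  simp only [hpt]
  refine (integral_add i3 ((i4.sub i5).add (i6.add i7))).trans ?_
  congr 1
  refine (integral_add (i4.sub i5) (i6.add i7)).trans ?_
  refine congrArg₂ (· + ·) ?_ ?_
  · refine (integral_sub i4 i5).trans ?_
    rw [integral_const_mul]
    rfl
  · refine (integral_add i6 i7).trans ?_
    rw [integral_const_mul]
    refine (congrArg (fun a => 2 * a + _) hcross).trans ?_
    rw [mul_zero, zero_add]
    rfl

theorem integral_totalCost (hr : r ∈ Set.Icc (0 : ℝ) 1) (hπ : Feasible N π)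
    (h : ∀ j < N, MemLp (fun ω => S.control π j (t, ω)) 2 P) :
    ∫ ω, S.totalCost π (t, ω) ∂P = ∫ ω, S.x₀ ω ⬝ᵥ S.riccati r 0 *ᵥ S.x₀ ω ∂P +
      ∑ k ∈ Finset.range N,
        (S.deviationTerm π r k t - (1 - r) * S.stateTerm π r k t + S.noiseTerm r k) := by
  have hx : ∀ k ≤ N, MemLp (fun ω => S.state π k (t, ω)) 2 P := fun k hk =>
    S.memLp_state (fun j hj => h j (hj.trans_le hk)) hk
  have hstage : ∀ k ∈ Finset.range N, Integrable (fun ω =>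
      S.state π k (t, ω) ⬝ᵥ S.Q k *ᵥ S.state π k (t, ω) +
        S.control π k (t, ω) ⬝ᵥ S.R k *ᵥ S.control π k (t, ω)) P := by
    intro k hk
    have hk' := Finset.mem_range.1 hk
    exact (integrable_quadForm _ (hx k hk'.le) (hx k hk'.le)).add
      (integrable_quadForm _ (h k hk') (h k hk'))
  have key : ∀ l ≤ N,
      ∫ ω, S.state π l (t, ω) ⬝ᵥ S.riccati r l *ᵥ S.state π l (t, ω) ∂P +
      ∑ k ∈ Finset.range l, ∫ ω, (S.state π k (t, ω) ⬝ᵥ S.Q k *ᵥ S.state π k (t, ω) +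
        S.control π k (t, ω) ⬝ᵥ S.R k *ᵥ S.control π k (t, ω)) ∂P =
      ∫ ω, S.x₀ ω ⬝ᵥ S.riccati r 0 *ᵥ S.x₀ ω ∂P + ∑ k ∈ Finset.range l,
        (S.deviationTerm π r k t - (1 - r) * S.stateTerm π r k t + S.noiseTerm r k) := by
    intro l hl
    induction l with
    | zero => simp [state, run]
    | succ l ih =>
      have h1 := S.integral_step (t := t) hr hπ hl fun j hj => h j (by omega)
      have h2 := ih (by omega)
      rw [Finset.sum_range_succ, Finset.sum_range_succ]
      linarith
  rw [← key N le_rfl, riccati_horizon, ← integral_finsetSum _ hstage, ← integral_add]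
  · rfl
  · exact integrable_quadForm _ (hx N le_rfl) (hx N le_rfl)
  · exact integrable_finsetSum _ hstage

theorem insert_onTimes_lt (hk : k < N) : ∀ i ∈ insert k (onTimes t k), i < N := by
  rintro i (rfl | hi)
  · exact hk
  · exact hi.1.trans hk

theorem errorTerm_antitone (hr : r ∈ Set.Icc (0 : ℝ) 1) (hk : k < N) :
    Antitone (S.errorTerm r k) := fun _ _ htt =>
  errorOf_antitone (S.info_mono (Set.insert_subset_insert (onTimes_subset_of_le htt k)))
    (S.info_le (insert_onTimes_lt hk)) (S.weight_posSemidef hr hk) _ (S.memLp_free hk.le)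

/-- The state is the free state plus a known shift, so its mean square is the error of estimating
the free state by minus that shift. -/
theorem errorTerm_le_stateTerm (hr : r ∈ Set.Icc (0 : ℝ) 1) (hπ : Feasible N π) (hk : k < N)
    (h : ∀ j < k, MemLp (fun ω => S.control π j (t, ω)) 2 P) :
    S.errorTerm r k t ≤ S.stateTerm π r k t := by
  have h1 := errorOf_le (S.info_le (insert_onTimes_lt (t := t) hk)) (S.weight_posSemidef hr hk)
    (S.gain r k) (S.memLp_free hk.le) (g := fun ω => S.shift k (S.run π (t, ω) k).2.2)
    ((S.measurable_shift_run_info hπ t hk.le).mono (S.info_mono (Set.subset_insert _ _)) le_rfl)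
    (S.memLp_shift_run h hk.le)
  unfold stateTerm
  simp only [state_eq]
  exact h1

/-- OFF, the control is 0 and the deviation is the state term; ON, Pythagoras splits it into error
and gap. This arrangement isolates the factor `r - 1{ON}`, whose sign is decided only after
averaging over the fog. -/
theorem deviationTerm_eq (hr : r ∈ Set.Icc (0 : ℝ) 1) (hπ : Feasible N π) (hk : k < N)
    (h : ∀ j < k + 1, MemLp (fun ω => S.control π j (t, ω)) 2 P) :
    S.deviationTerm π r k t - (1 - r) * S.stateTerm π r k t =
      (if fogAt t k then S.gapTerm π r k t else 0) + r * S.errorTerm r k t +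
        (r - if fogAt t k then 1 else 0) * (S.stateTerm π r k t - S.errorTerm r k t) := by
  cases ht : fogAt t k
  · have : S.deviationTerm π r k t = S.stateTerm π r k t := by
      unfold deviationTerm stateTerm
      simp only [S.control_eq_zero hπ hk ht, add_zero]
    simp only [this, Bool.false_eq_true, if_false]
    ring
  · have hshift := S.memLp_shift_run (fun j hj => h j (hj.trans (Nat.lt_succ_self k))) hk.le
    have hsm := (S.measurable_shift_run_info hπ t hk.le).mono
      (S.info_mono (onTimes_mono t (Nat.le_succ k))) le_rfl
    have h1 := integral_quadForm_condExp (S.info_onTimes_le t (Nat.succ_le_of_lt hk))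
      (transpose_eq_of_posSemidef (S.weight_posSemidef hr hk)) (S.gain r k) (S.memLp_free hk.le)
      (c := fun ω => S.gain r k *ᵥ S.shift k (S.run π (t, ω) k).2.2 + S.control π k (t, ω))
      (((measurable_mulVec _).comp hsm).add (S.measurable_control_info hπ t hk))
      ((memLp_mulVec _ hshift).add (h k (Nat.lt_succ_self k)))
    simp only [← add_assoc, ← mulVec_add] at h1
    have h2 : S.deviationTerm π r k t = S.errorTerm r k t + S.gapTerm π r k t := by
      unfold deviationTerm errorTerm errorOf gapTerm pathEstimate
      simp only [state_eq]
      rw [← onTimes_succ_of_on ht]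
      exact h1
    simp only [h2, if_true]
    ring

theorem pathCost_eq (hr : r ∈ Set.Icc (0 : ℝ) 1) (hπ : Feasible N π)
    (h : ∀ j < N, MemLp (fun ω => S.control π j (t, ω)) 2 P) :
    ∫ ω, S.totalCost π (t, ω) ∂P = ∫ ω, S.x₀ ω ⬝ᵥ S.riccati r 0 *ᵥ S.x₀ ω ∂P +
      ∑ k ∈ Finset.range N, (S.noiseTerm r k + ((if fogAt t k then S.gapTerm π r k t else 0) +
        r * S.errorTerm r k t +
        (r - if fogAt t k then 1 else 0) * (S.stateTerm π r k t - S.errorTerm r k t))) := by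
  rw [S.integral_totalCost hr hπ h]
  congr 1
  refine Finset.sum_congr rfl fun k hk => ?_
  have hk' := Finset.mem_range.1 hk
  rw [S.deviationTerm_eq hr hπ hk' fun j hj => h j (by omega)]
  ring

end Plant

/-! ### Averaging over paths and comparing fog parameters -/

namespace Plant

variable {n s m N : ℕ} {Ω : Type*} [mΩ : MeasurableSpace Ω] {P : Measure Ω}
  (S : Plant n s m N P) {π : Policy m s} {p q r : ℝ} {τ₀ : Bool}

section Cost

/-- Along every path of positive probability, the controls are square integrable. -/
def SquareIntegrableControl (π : Policy m s) (p q : ℝ) (τ₀ : Bool) : Prop :=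
  ∀ t, pathProb N p q τ₀ t ≠ 0 → ∀ k < N, MemLp (fun ω => S.control π k (t, ω)) 2 P

/-- The expected cost as a real number. -/
noncomputable def meanCost (π : Policy m s) (p q : ℝ) (τ₀ : Bool) : ℝ :=
  pathMean N p q τ₀ fun t => ∫ ω, S.totalCost π (t, ω) ∂P

theorem totalCost_nonneg (y : Sample N Ω) : 0 ≤ S.totalCost π y := by
  refine add_nonneg (quadForm_nonneg (S.posSemidef_Q N le_rfl) _) (Finset.sum_nonneg fun k hk => ?_)
  have hk' := Finset.mem_range.1 hk
  exact add_nonneg (quadForm_nonneg (S.posSemidef_Q k hk'.le) _)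
    (quadForm_nonneg (S.posDef_R k hk').posSemidef _)

theorem controlCost_le_totalCost {k : ℕ} (hk : k < N) (y : Sample N Ω) :
    S.control π k y ⬝ᵥ S.R k *ᵥ S.control π k y ≤ S.totalCost π y := by
  have h1 := quadForm_nonneg (S.posSemidef_Q N le_rfl) (S.state π N y)
  have h2 := quadForm_nonneg (S.posSemidef_Q k hk.le) (S.state π k y)
  have h3 := Finset.single_le_sum (f := fun k => S.state π k y ⬝ᵥ S.Q k *ᵥ S.state π k y +
      S.control π k y ⬝ᵥ S.R k *ᵥ S.control π k y) (s := Finset.range N) (fun j hj => by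
        have hj' := Finset.mem_range.1 hj
        exact add_nonneg (quadForm_nonneg (S.posSemidef_Q j hj'.le) _)
          (quadForm_nonneg (S.posDef_R j hj').posSemidef _)) (Finset.mem_range.2 hk)
  unfold totalCost
  linarith

theorem meanCost_nonneg (hp : p ∈ Set.Icc (0 : ℝ) 1) (hq : q ∈ Set.Icc (0 : ℝ) 1) :
    0 ≤ S.meanCost π p q τ₀ :=
  Finset.sum_nonneg fun t _ => mul_nonneg (pathProb_nonneg hp hq τ₀ t)
    (integral_nonneg fun _ => S.totalCost_nonneg _)

/-- Excess cost of a policy over the control law `-V_k E[x_k ∣ H_k]`. -/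
noncomputable def gapSum (r : ℝ) (π : Policy m s) (p q : ℝ) (τ₀ : Bool) : ℝ :=
  ∑ k ∈ Finset.range N, pathMean N p q τ₀ fun t => if fogAt t k then S.gapTerm π r k t else 0

/-- The contribution of the deterministic initial fog state. -/
noncomputable def startTerm (r : ℝ) (τ₀ : Bool) : ℝ :=
  (r - if τ₀ then 1 else 0) *
    (∫ ω, S.gain r 0 *ᵥ S.x₀ ω ⬝ᵥ S.weight r 0 *ᵥ S.gain r 0 *ᵥ S.x₀ ω ∂P -
      S.errorTerm r 0 fun _ => τ₀)

/-- The optimum cost of the symmetric case with ON probability `r`. -/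
noncomputable def baseCost (r : ℝ) (τ₀ : Bool) : ℝ :=
  ∫ ω, S.x₀ ω ⬝ᵥ S.riccati r 0 *ᵥ S.x₀ ω ∂P + ∑ k ∈ Finset.range N, (S.noiseTerm r k +
    r * pathMean N r (1 - r) τ₀ (S.errorTerm r k) + if k = 0 then S.startTerm r τ₀ else 0)

/-- Effect at time `k` of an ON probability that differs from `r`. -/
noncomputable def slackTerm (r : ℝ) (π : Policy m s) (p q : ℝ) (τ₀ : Bool) (k : ℕ) : ℝ :=
  pathMean N p q τ₀ fun t =>
    (r - if fogAt t k then 1 else 0) * (S.stateTerm π r k t - S.errorTerm r k t)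

/-- No control has acted yet and the fog state is fixed, so this term cancels from every comparison.
-/
theorem slackTerm_zero : S.slackTerm r π p q τ₀ 0 = S.startTerm r τ₀ := by
  have h : ∀ t, pathProb N p q τ₀ t ≠ 0 → (r - if fogAt t 0 then 1 else 0) *
      (S.stateTerm π r 0 t - S.errorTerm r 0 t) = S.startTerm r τ₀ := by
    intro t ht
    have h0 : fogAt t 0 = τ₀ := eq_of_pathProb_ne_zero ht
    have h1 : onTimes t 0 = onTimes (fun _ : Fin (N + 1) => τ₀) 0 :=
      onTimes_congr fun i hi => absurd hi (Nat.not_lt_zero i)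
    rw [h0, startTerm]
    unfold errorTerm
    rw [h1]
    rfl
  rw [slackTerm, pathMean_congr h, pathMean_const]

variable [IsProbabilityMeasure P]

theorem cost_eq_meanCost (hp : p ∈ Set.Icc (0 : ℝ) 1) (hq : q ∈ Set.Icc (0 : ℝ) 1)
    (h : S.SquareIntegrableControl π p q τ₀) :
    S.cost π p q τ₀ = ENNReal.ofReal (S.meanCost π p q τ₀) := by
  rw [cost, lintegral_law, meanCost, pathMean, ENNReal.ofReal_sum_of_nonneg fun t _ =>
    mul_nonneg (pathProb_nonneg hp hq τ₀ t) (integral_nonneg fun _ => S.totalCost_nonneg _)]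
  refine Finset.sum_congr rfl fun t _ => ?_
  by_cases ht : pathProb N p q τ₀ t = 0
  · simp [ht]
  · rw [ENNReal.ofReal_mul (pathProb_nonneg hp hq τ₀ t),
      ofReal_integral_eq_lintegral_ofReal (S.integrable_totalCost (h t ht))
        (Filter.Eventually.of_forall fun _ => S.totalCost_nonneg _)]

/-- The total cost dominates each control cost, and positive definiteness of `R_k` turns this into
square integrability. -/
theorem squareIntegrableControl_of_cost_ne_top (hp : p ∈ Set.Icc (0 : ℝ) 1)
    (hq : q ∈ Set.Icc (0 : ℝ) 1) (hπ : Feasible N π) (h : S.cost π p q τ₀ ≠ ⊤) :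
    S.SquareIntegrableControl π p q τ₀ := by
  intro t ht k hk
  rw [cost, lintegral_law] at h
  have h1 := ENNReal.sum_ne_top.1 h t (Finset.mem_univ _)
  have h0 : ENNReal.ofReal (pathProb N p q τ₀ t) ≠ 0 := by
    simpa using lt_of_le_of_ne (pathProb_nonneg hp hq τ₀ t) (Ne.symm ht)
  have h2 : ∫⁻ ω, ENNReal.ofReal (S.totalCost π (t, ω)) ∂P ≠ ⊤ := fun h3 =>
    h1 (by rw [h3, ENNReal.mul_top h0])
  refine memLp_two_of_posDef (S.posDef_R k hk) ((S.measurable_control_info hπ t hk).mono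
    (S.info_onTimes_le t hk) le_rfl) (ne_top_of_le_ne_top h2 (lintegral_mono fun ω => ?_))
  exact ENNReal.ofReal_le_ofReal (S.controlCost_le_totalCost hk _)

theorem meanCost_eq (hr : r ∈ Set.Icc (0 : ℝ) 1) (hπ : Feasible N π)
    (h : S.SquareIntegrableControl π p q τ₀) :
    S.meanCost π p q τ₀ = ∫ ω, S.x₀ ω ⬝ᵥ S.riccati r 0 *ᵥ S.x₀ ω ∂P + (S.gapSum r π p q τ₀ +
      ∑ k ∈ Finset.range N, (S.noiseTerm r k + r * pathMean N p q τ₀ (S.errorTerm r k) +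
        S.slackTerm r π p q τ₀ k)) := by
  rw [meanCost, pathMean_congr fun t ht => S.pathCost_eq hr hπ (h t ht), pathMean_add,
    pathMean_const, pathMean_sum, gapSum, ← Finset.sum_add_distrib]
  congr 1
  refine Finset.sum_congr rfl fun k _ => ?_
  rw [pathMean_add, pathMean_const, pathMean_add, pathMean_add, pathMean_const_mul, slackTerm]
  ring

/-- The state and error terms at `k + 1` depend only on the fog up to `k`, so `pathMean_next`
replaces the indicator by its conditional probability. The maximum with 0 changes nothing on
possible paths and makes the factor nonnegative on all paths. -/
theorem slackTerm_succ (hr : r ∈ Set.Icc (0 : ℝ) 1) (hπ : Feasible N π)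
    (h : S.SquareIntegrableControl π p q τ₀) {k : ℕ} (hk : k + 1 < N) :
    S.slackTerm r π p q τ₀ (k + 1) = pathMean N p q τ₀ fun t =>
      (r - transition p q (fogAt t k) true) *
        max (S.stateTerm π r (k + 1) t - S.errorTerm r (k + 1) t) 0 := by
  have hY : ∀ t, pathProb N p q τ₀ t ≠ 0 →
      S.stateTerm π r (k + 1) t - S.errorTerm r (k + 1) t =
        max (S.stateTerm π r (k + 1) t - S.errorTerm r (k + 1) t) 0 := fun t ht =>
    (max_eq_left (sub_nonneg.2 (S.errorTerm_le_stateTerm hr hπ hk fun j hj =>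
      h t ht j (hj.trans hk)))).symm
  have hnext := pathMean_next (p := p) (q := q) (⟨k, by omega⟩ : Fin N) τ₀
    (Y := fun t => max (S.stateTerm π r (k + 1) t - S.errorTerm r (k + 1) t) 0) (by
      intro t t' htt
      have h1 : ∀ i < k + 1, fogAt t i = fogAt t' i := by
        intro i hi
        have hi' : i < N + 1 := by omega
        simp only [fogAt, hi', dif_pos]
        exact htt ⟨i, hi'⟩ (Nat.lt_succ_iff.1 hi)
      simp only [stateTerm, errorTerm, S.state_congr π h1, onTimes_congr h1])
  have e1 : ∀ t : Fin (N + 1) → Bool, t (⟨k, by omega⟩ : Fin N).succ = fogAt t (k + 1) := fun t => by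
    simp [fogAt, show k + 1 < N + 1 by omega]
  have e2 : ∀ t : Fin (N + 1) → Bool, t (⟨k, by omega⟩ : Fin N).castSucc = fogAt t k := fun t => by
    simp [fogAt, show k < N + 1 by omega]
  simp only [e1, e2] at hnext
  have hsum : S.slackTerm r π p q τ₀ (k + 1) = pathMean N p q τ₀ fun t =>
      (r - if fogAt t (k + 1) then 1 else 0) *
        max (S.stateTerm π r (k + 1) t - S.errorTerm r (k + 1) t) 0 :=
    pathMean_congr fun t ht => by rw [← hY t ht]
  refine (add_zero _).symm.trans ?_
  rw [hsum]
  refine (congrArg (_ + ·) hnext.symm).trans ?_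
  rw [← pathMean_add]
  congr 1
  funext t
  ring

theorem slackTerm_nonneg (hp : p ∈ Set.Icc (0 : ℝ) 1) (hq : q ∈ Set.Icc (0 : ℝ) 1)
    (hr : r ∈ Set.Icc (0 : ℝ) 1) (hπ : Feasible N π) (h : S.SquareIntegrableControl π p q τ₀)
    (hpr : p ≤ r) (hqr : 1 - q ≤ r) {k : ℕ} (hk : k + 1 < N) :
    0 ≤ S.slackTerm r π p q τ₀ (k + 1) := by
  rw [S.slackTerm_succ hr hπ h hk]
  refine Finset.sum_nonneg fun t _ => mul_nonneg (pathProb_nonneg hp hq τ₀ t)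
    (mul_nonneg ?_ (le_max_right _ _))
  cases fogAt t k
  · simp only [transition]; linarith
  · simp only [transition]; linarith

theorem slackTerm_nonpos (hp : p ∈ Set.Icc (0 : ℝ) 1) (hq : q ∈ Set.Icc (0 : ℝ) 1)
    (hr : r ∈ Set.Icc (0 : ℝ) 1) (hπ : Feasible N π) (h : S.SquareIntegrableControl π p q τ₀)
    (hpr : r ≤ p) (hqr : r ≤ 1 - q) {k : ℕ} (hk : k + 1 < N) :
    S.slackTerm r π p q τ₀ (k + 1) ≤ 0 := by
  rw [S.slackTerm_succ hr hπ h hk]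
  refine Finset.sum_nonpos fun t _ => mul_nonpos_of_nonneg_of_nonpos (pathProb_nonneg hp hq τ₀ t)
    (mul_nonpos_of_nonpos_of_nonneg ?_ (le_max_right _ _))
  cases fogAt t k
  · simp only [transition]; linarith
  · simp only [transition]; linarith

/-- The symmetric chain with parameter `r` favours ON at least as much, so its mean errors are no
larger, and the slack after time 0 is nonnegative. In `meanCost_le` both comparisons are reversed.
-/
theorem baseCost_add_gapSum_le (hp : p ∈ Set.Icc (0 : ℝ) 1) (hq : q ∈ Set.Icc (0 : ℝ) 1)
    (hr : r ∈ Set.Icc (0 : ℝ) 1) (hπ : Feasible N π) (h : S.SquareIntegrableControl π p q τ₀)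
    (hpq : 1 - q ≤ p) (hpr : p ≤ r) :
    S.baseCost r τ₀ + S.gapSum r π p q τ₀ ≤ S.meanCost π p q τ₀ := by
  rw [S.meanCost_eq hr hπ h, baseCost, add_assoc, add_comm (Finset.sum _ _)]
  refine add_le_add le_rfl (add_le_add le_rfl (Finset.sum_le_sum fun k hk => ?_))
  have hk' := Finset.mem_range.1 hk
  refine add_le_add (add_le_add le_rfl (mul_le_mul_of_nonneg_left ?_ hr.1)) ?_
  · exact pathMean_le_of_transition_le hp hq hr ⟨by linarith [hr.2], by linarith [hr.1]⟩ hpq hpr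
      (by linarith) τ₀ (S.errorTerm_antitone hr hk')
  · cases k with
    | zero => rw [if_pos rfl, slackTerm_zero]
    | succ k =>
      rw [if_neg (Nat.succ_ne_zero k)]
      exact S.slackTerm_nonneg hp hq hr hπ h hpr (hpq.trans hpr) hk'

theorem meanCost_le (hp : p ∈ Set.Icc (0 : ℝ) 1) (hq : q ∈ Set.Icc (0 : ℝ) 1)
    (hr : r ∈ Set.Icc (0 : ℝ) 1) (hπ : Feasible N π) (h : S.SquareIntegrableControl π p q τ₀)
    (hpr : r ≤ p) (hqr : r ≤ 1 - q) :
    S.meanCost π p q τ₀ ≤ S.baseCost r τ₀ + S.gapSum r π p q τ₀ := by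
  rw [S.meanCost_eq hr hπ h, baseCost, add_assoc _ _ (gapSum _ _ _ _ _ _),
    add_comm (Finset.sum _ _) (gapSum _ _ _ _ _ _)]
  refine add_le_add le_rfl (add_le_add le_rfl (Finset.sum_le_sum fun k hk => ?_))
  have hk' := Finset.mem_range.1 hk
  refine add_le_add (add_le_add le_rfl (mul_le_mul_of_nonneg_left ?_ hr.1)) ?_
  · exact pathMean_le_of_transition_le hr ⟨by linarith [hr.2], by linarith [hr.1]⟩ hp hq
      (by linarith) hpr (by linarith) τ₀ (S.errorTerm_antitone hr hk')
  · cases k with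
    | zero => rw [if_pos rfl, slackTerm_zero]
    | succ k =>
      rw [if_neg (Nat.succ_ne_zero k)]
      exact S.slackTerm_nonpos hp hq hr hπ h hpr hqr hk'

end Cost

end Plant

namespace Plant

variable {n s m N : ℕ} {Ω : Type*} [mΩ : MeasurableSpace Ω] {P : Measure Ω}
  (S : Plant n s m N P) {π : Policy m s} {p q r : ℝ} {τ₀ : Bool}

/-! ### Policies that follow the gains, and their existence -/

section Gain

/-- Along the path `t`, the policy applies the control `-V_k E[x_k ∣ H_k]` at time `k` if it
is ON. -/
def FollowsGain (r : ℝ) (π : Policy m s) (t : Fin (N + 1) → Bool) (k : ℕ) : Prop :=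
  (fun ω => S.control π k (t, ω)) =ᵐ[P]
    fun ω => if fogAt t k then -(S.gain r k *ᵥ S.pathEstimate π k t ω) else 0

theorem gapTerm_eq_zero {k : ℕ} {t : Fin (N + 1) → Bool} (h : S.FollowsGain r π t k)
    (ht : fogAt t k = true) : S.gapTerm π r k t = 0 := by
  refine integral_eq_zero_of_ae ?_
  filter_upwards [h] with ω hω
  simp only [ht, if_true] at hω
  rw [hω, add_neg_cancel]
  simp

theorem memLp_pathEstimate {k : ℕ} {t : Fin (N + 1) → Bool}
    (h : ∀ j < k, MemLp (fun ω => S.control π j (t, ω)) 2 P) (hk : k ≤ N) :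
    MemLp (S.pathEstimate π k t) 2 P :=
  ((S.memLp_free hk).condExp (by norm_num)).add (S.memLp_shift_run h hk)

theorem gapSum_eq_zero (h : ∀ t, pathProb N p q τ₀ t ≠ 0 → ∀ k < N, S.FollowsGain r π t k) :
    S.gapSum r π p q τ₀ = 0 := by
  refine Finset.sum_eq_zero fun k hk => ?_
  refine (pathMean_congr fun t ht => ?_).trans (pathMean_const N τ₀ 0)
  split_ifs with hf
  · exact S.gapTerm_eq_zero (h t ht k (Finset.mem_range.1 hk)) hf
  · rfl

theorem gapSum_nonneg (hp : p ∈ Set.Icc (0 : ℝ) 1) (hq : q ∈ Set.Icc (0 : ℝ) 1)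
    (hr : r ∈ Set.Icc (0 : ℝ) 1) : 0 ≤ S.gapSum r π p q τ₀ := by
  refine Finset.sum_nonneg fun k hk => Finset.sum_nonneg fun t _ =>
    mul_nonneg (pathProb_nonneg hp hq τ₀ t) ?_
  beta_reduce
  split_ifs
  · exact S.gapTerm_nonneg hr (Finset.mem_range.1 hk)
  · exact le_rfl

/-- If the gap sum vanishes on a system in which all paths are possible, then it vanishes for all
fog parameters. -/
theorem gapSum_eq_zero_of_eq_zero {p' q' : ℝ} (hp : p ∈ Set.Ioo (0 : ℝ) 1)
    (hq : q ∈ Set.Ioo (0 : ℝ) 1) (hr : r ∈ Set.Icc (0 : ℝ) 1) (h : S.gapSum r π p q τ₀ = 0) :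
    S.gapSum r π p' q' τ₀ = 0 := by
  have hnn : ∀ k ∈ Finset.range N, ∀ t : Fin (N + 1) → Bool,
      0 ≤ if fogAt t k then S.gapTerm π r k t else 0 := by
    intro k hk t
    split_ifs
    · exact S.gapTerm_nonneg hr (Finset.mem_range.1 hk)
    · exact le_rfl
  have hpp := fun t => pathProb_nonneg (N := N) ⟨hp.1.le, hp.2.le⟩ ⟨hq.1.le, hq.2.le⟩ τ₀ t
  have h1 := (Finset.sum_eq_zero_iff_of_nonneg fun k hk => Finset.sum_nonneg fun t _ =>
    mul_nonneg (hpp t) (hnn k hk t)).1 h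
  refine Finset.sum_eq_zero fun k hk => ?_
  have h2 := (Finset.sum_eq_zero_iff_of_nonneg fun t _ => mul_nonneg (hpp t) (hnn k hk t)).1 (h1 k hk)
  refine (pathMean_congr fun t ht => ?_).trans (pathMean_const N τ₀ 0)
  exact (mul_eq_zero.1 (h2 t (Finset.mem_univ _))).resolve_left
    (pathProb_pos hp hq (eq_of_pathProb_ne_zero ht)).ne'

/-- Square integrability propagates forward in time: earlier controls give it for the estimate, and
the next control is linear in the estimate or 0. -/
theorem memLp_control_of_followsGain {k : ℕ} {t : Fin (N + 1) → Bool} (hk : k ≤ N)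
    (h : ∀ j < k, S.FollowsGain r π t j) : ∀ j < k, MemLp (fun ω => S.control π j (t, ω)) 2 P := by
  induction k with
  | zero => exact fun j hj => absurd hj (Nat.not_lt_zero j)
  | succ k ih =>
    have ih' := ih (by omega) fun j hj => h j (by omega)
    intro j hj
    rcases Nat.lt_succ_iff_lt_or_eq.1 hj with hj | rfl
    · exact ih' j hj
    · refine MemLp.ae_eq (h j (Nat.lt_succ_self j)).symm ?_
      split_ifs
      · exact (memLp_mulVec _ (S.memLp_pathEstimate ih' (by omega))).neg
      · exact MemLp.zero'

theorem squareIntegrableControl_of_followsGain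
    (h : ∀ t, pathProb N p q τ₀ t ≠ 0 → ∀ k < N, S.FollowsGain r π t k) :
    S.SquareIntegrableControl π p q τ₀ := fun t ht =>
  S.memLp_control_of_followsGain le_rfl (h t ht)

variable [IsProbabilityMeasure P]

theorem condExp_state (hπ : Feasible N π) {k : ℕ} (hk : k < N) {t : Fin (N + 1) → Bool}
    (h : ∀ j < k, MemLp (fun ω => S.control π j (t, ω)) 2 P) :
    P[fun ω => S.state π k (t, ω) | S.info (onTimes t (k + 1))] =ᵐ[P] S.pathEstimate π k t := by
  have hshift := S.memLp_shift_run h hk.le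
  have hm := S.info_onTimes_le t (Nat.succ_le_of_lt hk)
  have hsm : Measurable[S.info (onTimes t (k + 1))] fun ω => S.shift k (S.run π (t, ω) k).2.2 :=
    (S.measurable_shift_run_info hπ t hk.le).mono
      (S.info_mono (onTimes_mono t (Nat.le_succ k))) le_rfl
  have h1 := condExp_add ((S.memLp_free hk.le).integrable (by norm_num))
    (hshift.integrable (by norm_num)) (S.info (onTimes t (k + 1)))
  rw [condExp_of_stronglyMeasurable hm hsm.stronglyMeasurable
    (hshift.integrable (by norm_num))] at h1
  have h2 : (fun ω => S.state π k (t, ω)) =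
      S.free k + fun ω => S.shift k (S.run π (t, ω) k).2.2 := by
    funext ω
    rw [state_eq, Pi.add_apply]
  rw [h2]
  exact h1

theorem estimate_ae_eq (hp : p ∈ Set.Icc (0 : ℝ) 1) (hq : q ∈ Set.Icc (0 : ℝ) 1)
    (hπ : Feasible N π) {k : ℕ} (hk : k < N)
    (h : ∀ t, pathProb N p q τ₀ t ≠ 0 → ∀ j < k, MemLp (fun ω => S.control π j (t, ω)) 2 P)
    {t : Fin (N + 1) → Bool} (ht : pathProb N p q τ₀ t ≠ 0) :
    (fun ω => S.estimate π p q τ₀ k (t, ω)) =ᵐ[P] S.pathEstimate π k t :=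
  (S.estimate_slice τ₀ hp hq hπ hk (fun t ht =>
    (S.memLp_state (h t ht) hk.le).integrable (by norm_num)) ht).trans
      (S.condExp_state hπ hk (h t ht))

theorem applies_iff_followsGain (hp : p ∈ Set.Icc (0 : ℝ) 1) (hq : q ∈ Set.Icc (0 : ℝ) 1)
    (hπ : Feasible N π) {k : ℕ} (hk : k < N)
    (h : ∀ t, pathProb N p q τ₀ t ≠ 0 → ∀ j < k, MemLp (fun ω => S.control π j (t, ω)) 2 P) :
    (S.control π k =ᵐ[S.law p q τ₀]
      fun y => if fog k y then -(S.gain r k *ᵥ S.estimate π p q τ₀ k y) else 0) ↔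
      ∀ t, pathProb N p q τ₀ t ≠ 0 → S.FollowsGain r π t k := by
  unfold Filter.EventuallyEq
  rw [S.ae_law_iff τ₀ hp hq]
  refine forall₂_congr fun t ht => ?_
  have h1 := S.estimate_ae_eq hp hq hπ hk h ht
  refine Filter.eventually_congr ?_
  filter_upwards [h1] with ω hω
  rw [hω]
  rfl

/-- `FollowsGain` mentions no fog parameters, so it can be moved between systems. Identifying the
two estimates at time `k` uses square integrable earlier controls, which the control law supplies at
earlier times; hence the induction. -/
theorem appliesSymmetricControl_iff (hp : p ∈ Set.Icc (0 : ℝ) 1) (hq : q ∈ Set.Icc (0 : ℝ) 1)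
    (hπ : Feasible N π) : S.AppliesSymmetricControl r π p q τ₀ ↔
      ∀ t, pathProb N p q τ₀ t ≠ 0 → ∀ k < N, S.FollowsGain r π t k := by
  constructor
  · intro h
    have key : ∀ k ≤ N, ∀ t, pathProb N p q τ₀ t ≠ 0 → ∀ j < k, S.FollowsGain r π t j := by
      intro k hk
      induction k with
      | zero => exact fun t _ j hj => absurd hj (Nat.not_lt_zero j)
      | succ k ih =>
        intro t ht j hj
        rcases Nat.lt_succ_iff_lt_or_eq.1 hj with hj | rfl
        · exact ih (by omega) t ht j hj
        · exact (S.applies_iff_followsGain hp hq hπ hk fun t ht =>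
            S.memLp_control_of_followsGain (by omega) (ih (by omega) t ht)).1 (h j hk) t ht
    exact fun t ht k hk => key N le_rfl t ht k hk
  · intro h k hk
    exact (S.applies_iff_followsGain hp hq hπ hk fun t ht =>
      S.memLp_control_of_followsGain hk.le fun j hj => h t ht j (hj.trans hk)).2
        fun t ht => h t ht k hk

/-- There is a policy that applies the gains to the conditional mean of the state, whatever the
fog parameters are. -/
theorem exists_followsGain (r : ℝ) (τ₀ : Bool) : ∃ π : Policy m s, Feasible N π ∧
    ∀ t : Fin (N + 1) → Bool, t 0 = τ₀ → ∀ k < N, S.FollowsGain r π t k := by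
  have hhalf : (1 / 2 : ℝ) ∈ Set.Ioo (0 : ℝ) 1 := by norm_num
  have hhalf' : (1 / 2 : ℝ) ∈ Set.Icc (0 : ℝ) 1 := by norm_num
  -- With parameters 1/2 every path from `τ₀` has positive probability, so one measurable function
  -- of the uncontrolled history is a version of the conditional mean on all of them at once, and
  -- serves every pair of parameters.
  have hφ : ∀ k, ∃ φ : History m s k → (Fin n → ℝ), Measurable φ ∧
      S.estimate idle (1 / 2) (1 / 2) τ₀ k = φ ∘ S.history idle k := by
    intro k
    obtain ⟨g, hg, hgE⟩ := (stronglyMeasurable_condExp (μ := S.law (1 / 2) (1 / 2) τ₀)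
      (f := S.state idle k)
      (m := MeasurableSpace.comap (S.history idle k) inferInstance)).exists_eq_measurable_comp
    exact ⟨g, hg.measurable, hgE⟩
  choose φ hφm hφe using hφ
  refine ⟨fun k h b => if b then
    -(S.gain r k *ᵥ (φ k (S.freeHistory k h) + S.shift k h.2)) else 0, ?_, ?_⟩
  · refine fun k _ => ⟨fun b => ?_, fun _ => rfl⟩
    cases b
    · exact measurable_const
    · have h1 : Measurable fun h : History m s k => φ k (S.freeHistory k h) :=
        (hφm k).comp (S.measurable_freeHistory k)
      have h2 : Measurable fun h : History m s k => S.shift k h.2 :=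
        (S.measurable_shift k).comp measurable_snd
      exact ((measurable_mulVec _).comp (h1.add h2)).neg
  · intro t ht k hk
    set π : Policy m s := fun k h b => if b then
      -(S.gain r k *ᵥ (φ k (S.freeHistory k h) + S.shift k h.2)) else 0
    have hidle : ∀ t, pathProb N (1 / 2) (1 / 2) τ₀ t ≠ 0 → ∀ j < k,
        MemLp (fun ω => S.control (idle : Policy m s) j (t, ω)) 2 P := fun _ _ _ _ => MemLp.zero'
    have h1 := S.estimate_ae_eq hhalf' hhalf' feasible_idle hk hidle
      (pathProb_pos hhalf hhalf ht).ne'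
    filter_upwards [h1] with ω hω
    have h2 : S.control π k (t, ω) = if fogAt t k then -(S.gain r k *ᵥ
        (φ k (S.freeHistory k (S.history π k (t, ω))) + S.shift k (S.history π k (t, ω)).2))
        else 0 := rfl
    have h3 : φ k (S.freeHistory k (S.history π k (t, ω))) =
        (P[S.free k | S.info (onTimes t (k + 1))]) ω := by
      rw [freeHistory_history]
      have h4 : φ k (S.history idle k (t, ω)) = S.estimate idle (1 / 2) (1 / 2) τ₀ k (t, ω) := by
        rw [hφe]
        rfl
      rw [h4, hω, pathEstimate, run_idle_controls, shift_zero, add_zero]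
    rw [h2, h3]
    rfl

end Gain

/-! ### The symmetric optimum and the bounds it gives -/

section Optimum

variable [IsProbabilityMeasure P]

/-- When `p = r = 1 - q`, both comparisons apply, and the gap is zero. -/
theorem cost_of_followsGain_symmetric (hr : r ∈ Set.Icc (0 : ℝ) 1) (hp : p = r) (hq : q = 1 - r)
    (hπ : Feasible N π) (h : ∀ t, pathProb N p q τ₀ t ≠ 0 → ∀ k < N, S.FollowsGain r π t k) :
    S.meanCost π p q τ₀ = S.baseCost r τ₀ := by
  have hp' : p ∈ Set.Icc (0 : ℝ) 1 := hp ▸ hr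
  have hq' : q ∈ Set.Icc (0 : ℝ) 1 := ⟨by linarith [hr.2], by linarith [hr.1]⟩
  have hs := S.squareIntegrableControl_of_followsGain h
  have h0 := S.gapSum_eq_zero h
  have h1 := S.baseCost_add_gapSum_le hp' hq' hr hπ hs (by linarith) hp.le
  have h2 := S.meanCost_le hp' hq' hr hπ hs hp.ge (by linarith)
  rw [h0] at h1 h2
  linarith

theorem baseCost_le_cost (hp : p ∈ Set.Icc (0 : ℝ) 1) (hq : q ∈ Set.Icc (0 : ℝ) 1)
    (hr : r ∈ Set.Icc (0 : ℝ) 1) (hpq : 1 - q ≤ p) (hpr : p ≤ r) (hπ : Feasible N π) :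
    ENNReal.ofReal (S.baseCost r τ₀) ≤ S.cost π p q τ₀ := by
  by_cases h : S.cost π p q τ₀ = ⊤
  · rw [h]; exact le_top
  · have hs := S.squareIntegrableControl_of_cost_ne_top hp hq hπ h
    rw [S.cost_eq_meanCost hp hq hs]
    exact ENNReal.ofReal_le_ofReal (by
      linarith [S.baseCost_add_gapSum_le hp hq hr hπ hs hpq hpr,
        S.gapSum_nonneg (π := π) (τ₀ := τ₀) hp hq hr])

/-- The nonnegative gap gives the lower bound, and a policy following the gains attains it. -/
theorem minCost_symmetric (hr : r ∈ Set.Icc (0 : ℝ) 1) (hp : p = r) (hq : q = 1 - r) :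
    S.minCost p q τ₀ = ENNReal.ofReal (S.baseCost r τ₀) := by
  have hp' : p ∈ Set.Icc (0 : ℝ) 1 := hp ▸ hr
  have hq' : q ∈ Set.Icc (0 : ℝ) 1 := ⟨by linarith [hr.2], by linarith [hr.1]⟩
  refine le_antisymm ?_ (le_iInf₂ fun π hπ =>
    S.baseCost_le_cost hp' hq' hr (by linarith) hp.le hπ)
  obtain ⟨π, hπ, h⟩ := S.exists_followsGain r τ₀
  have h' : ∀ t, pathProb N p q τ₀ t ≠ 0 → ∀ k < N, S.FollowsGain r π t k := fun t ht =>
    h t (eq_of_pathProb_ne_zero ht)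
  rw [← S.cost_of_followsGain_symmetric hr hp hq hπ h',
    ← S.cost_eq_meanCost hp' hq' (S.squareIntegrableControl_of_followsGain h')]
  exact iInf₂_le π hπ

theorem baseCost_nonneg (hr : r ∈ Set.Icc (0 : ℝ) 1) : 0 ≤ S.baseCost r τ₀ := by
  obtain ⟨π, hπ, h⟩ := S.exists_followsGain r τ₀
  rw [← S.cost_of_followsGain_symmetric hr rfl rfl hπ fun t ht =>
    h t (eq_of_pathProb_ne_zero ht)]
  exact S.meanCost_nonneg hr ⟨by linarith [hr.2], by linarith [hr.1]⟩

theorem cost_le_of_gapSum_eq_zero (hp : p ∈ Set.Icc (0 : ℝ) 1) (hq : q ∈ Set.Icc (0 : ℝ) 1)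
    (hr : r ∈ Set.Icc (0 : ℝ) 1) (hpr : r ≤ p) (hqr : r ≤ 1 - q) (hπ : Feasible N π)
    (hs : S.SquareIntegrableControl π p q τ₀) (h : S.gapSum r π p q τ₀ = 0) :
    S.cost π p q τ₀ ≤ ENNReal.ofReal (S.baseCost r τ₀) := by
  rw [S.cost_eq_meanCost hp hq hs]
  exact ENNReal.ofReal_le_ofReal (by linarith [S.meanCost_le hp hq hr hπ hs hpr hqr])

end Optimum

end Plant

end FogControl

theorem theorem4 {n s m N : ℕ} {Ω : Type*} [MeasurableSpace Ω] {P : Measure Ω}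
    [IsProbabilityMeasure P] (S : FogControl.Plant n s m N P) (p q : ℝ)
    (hp : p ∈ Set.Icc (0 : ℝ) 1) (hq : q ∈ Set.Icc (0 : ℝ) 1) (hpq : 1 - q < p) (τ₀ : Bool) :
    -- the two bounds (between finite quantities)
    S.minCost (1 - q) q τ₀ < ⊤ ∧
    S.minCost p q τ₀ ≤ S.minCost (1 - q) q τ₀ ∧
    S.minCost p (1 - p) τ₀ ≤ S.minCost p q τ₀ ∧
    -- the optimum control of the symmetric case exists, is optimal in the symmetric case, and
    -- attains a cost between the two bounds in the system with parameters `p`, `q`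
    (∃ π : FogControl.Policy m s, FogControl.Feasible N π ∧
      S.AppliesSymmetricControl (1 - q) π (1 - q) q τ₀ ∧
      S.AppliesSymmetricControl (1 - q) π p q τ₀) ∧
    (∀ π : FogControl.Policy m s, FogControl.Feasible N π →
      S.AppliesSymmetricControl (1 - q) π (1 - q) q τ₀ →
      S.AppliesSymmetricControl (1 - q) π p q τ₀ →
        S.cost π (1 - q) q τ₀ = S.minCost (1 - q) q τ₀ ∧
        S.minCost p (1 - p) τ₀ ≤ S.cost π p q τ₀ ∧
        S.cost π p q τ₀ ≤ S.minCost (1 - q) q τ₀) ∧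
    -- unless the symmetric system is never ON after time 0, the same holds for every policy that
    -- is optimal in the symmetric case
    (q < 1 → ∀ π : FogControl.Policy m s, FogControl.Feasible N π →
      S.cost π (1 - q) q τ₀ = S.minCost (1 - q) q τ₀ →
        S.minCost p (1 - p) τ₀ ≤ S.cost π p q τ₀ ∧
        S.cost π p q τ₀ ≤ S.minCost (1 - q) q τ₀) := by
  have hr : 1 - q ∈ Set.Icc (0 : ℝ) 1 := ⟨by linarith [hq.2], by linarith [hq.1]⟩
  have hp1 : 1 - p ∈ Set.Icc (0 : ℝ) 1 := ⟨by linarith [hp.2], by linarith [hp.1]⟩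
  have hsym := S.minCost_symmetric (τ₀ := τ₀) hr rfl (by ring : q = 1 - (1 - q))
  have hsymp := S.minCost_symmetric (τ₀ := τ₀) hp rfl rfl
  have hlow : ∀ π : FogControl.Policy m s, FogControl.Feasible N π →
      S.minCost p (1 - p) τ₀ ≤ S.cost π p q τ₀ := fun π hπ => by
    rw [hsymp]
    exact S.baseCost_le_cost hp hq hp hpq.le le_rfl hπ
  have hup : ∀ π : FogControl.Policy m s, FogControl.Feasible N π →
      (∀ t, FogControl.pathProb N p q τ₀ t ≠ 0 → ∀ k < N, S.FollowsGain (1 - q) π t k) →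
      S.cost π p q τ₀ ≤ S.minCost (1 - q) q τ₀ := fun π hπ h => by
    rw [hsym]
    exact S.cost_le_of_gapSum_eq_zero hp hq hr hpq.le le_rfl hπ
      (S.squareIntegrableControl_of_followsGain h) (S.gapSum_eq_zero h)
  obtain ⟨π₀, hπ₀, h₀⟩ := S.exists_followsGain (1 - q) τ₀
  have h₀' : ∀ p' q' t, FogControl.pathProb N p' q' τ₀ t ≠ 0 → ∀ k < N,
      S.FollowsGain (1 - q) π₀ t k := fun _ _ t ht =>
    h₀ t (FogControl.eq_of_pathProb_ne_zero ht)
  refine ⟨?_, ?_, le_iInf₂ hlow, ?_, ?_, ?_⟩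
  · rw [hsym]
    exact ENNReal.ofReal_lt_top
  · exact (iInf₂_le π₀ hπ₀).trans (hup π₀ hπ₀ (h₀' p q))
  · exact ⟨π₀, hπ₀, (S.appliesSymmetricControl_iff hr hq hπ₀).2 (h₀' (1 - q) q),
      (S.appliesSymmetricControl_iff hp hq hπ₀).2 (h₀' p q)⟩
  · intro π hπ h1 h2
    have h1' := (S.appliesSymmetricControl_iff hr hq hπ).1 h1
    refine ⟨?_, hlow π hπ, hup π hπ ((S.appliesSymmetricControl_iff hp hq hπ).1 h2)⟩
    rw [hsym, S.cost_eq_meanCost hr hq (S.squareIntegrableControl_of_followsGain h1'),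
      S.cost_of_followsGain_symmetric hr rfl (by ring) hπ h1']
  · intro hq1 π hπ h
    refine ⟨hlow π hπ, ?_⟩
    -- From `1 - q < p ≤ 1` follows `0 < q`. So every path from `τ₀` is possible in the symmetric
    -- system, and what holds on its possible paths holds on those of `(p, q)`.
    have hr' : 1 - q ∈ Set.Ioo (0 : ℝ) 1 := ⟨by linarith, by linarith [hp.2]⟩
    have hq' : q ∈ Set.Ioo (0 : ℝ) 1 := ⟨by linarith [hp.2], hq1⟩
    have hs := S.squareIntegrableControl_of_cost_ne_top hr hq hπ (by
      rw [h, hsym]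
      exact ENNReal.ofReal_ne_top)
    rw [S.cost_eq_meanCost hr hq hs, hsym, ENNReal.ofReal_eq_ofReal_iff
      (S.meanCost_nonneg hr hq) (S.baseCost_nonneg hr)] at h
    -- Optimality makes the mean cost equal to `baseCost`, which leaves no room for a positive gap.
    have hle := S.baseCost_add_gapSum_le hr hq hr hπ hs le_rfl le_rfl
    have hgap : S.gapSum (1 - q) π (1 - q) q τ₀ = 0 :=
      le_antisymm (by linarith) (S.gapSum_nonneg hr hq hr)
    rw [hsym]
    exact S.cost_le_of_gapSum_eq_zero hp hq hr hpq.le le_rfl hπ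
      (fun t ht => hs t (FogControl.pathProb_pos hr' hq'
        (FogControl.eq_of_pathProb_ne_zero ht)).ne')
      (S.gapSum_eq_zero_of_eq_zero hr' hq' hr hgap)
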